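/- **Definitions.** For $1<\beta<2$ and $0\le\alpha\le 2-\beta$ put $p=(1-\alpha)/\beta$ and $J_{\beta,\alpha}=[-\alpha/(\beta-1),(1-\alpha)/(\beta-1)]$, and let $T^{\pm}_{\beta,\alpha}\colon J_{\beta,\alpha}\to J_{\beta,\alpha}$ be given by $T^{+}_{\beta,\alpha}(x)=\beta x+\alpha$ if $x<p$ and $\beta x+\alpha-1$ otherwise, and $T^{-}_{\beta,\alpha}(x)=\beta x+\alpha$ if $x\le p$ and $\beta x+\alpha-1$ otherwise. Let $\tau^{\pm}_{\beta,\alpha}(x)\in\{0,1\}^{\mathbb N}$ be the itinerary of $x\in J_{\beta,\alpha}$ whose $i$-th letter ($i\ge 1$) is $0$ if $(T^{+}_{\beta,\alpha})^{i-1}(x)<p$ (respectively $(T^{-}_{\beta,\alpha})^{i-1}(x)\le p$) and $1$ otherwise, and let $\Omega_{\beta,\alpha}=\tau^{+}_{\beta,\alpha}(J_{\beta,\alpha})\cup\tau^{-}_{\beta,\alpha}(J_{\beta,\alpha})$. A (one-sided) subshift over a finite alphabet $A$ is a closed subset of $A^{\mathbb N}$ that the left shift $\sigma$ maps into itself. It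 is *of finite type* if it is the set of all sequences in which no word of some finite set of finite words occurs. A subshift of $\{0,1\}^{\mathbb N}$ is *sofic* if it is a factor (the image under a continuous map commuting with $\sigma$) of a subshift of finite type over some finite alphabet. For $m\ge 2$ let $\beta_m$ be the unique solution of $x^m=x^{m-1}+\dots+x+1$ in $(1,2)$. A *Pisot number* is a real algebraic integer $\beta>1$ all of whose other Galois conjugates have modulus less than $1$. Let $1\le k<n$ be integers with $\gcd(n,k)=1$. For $\beta>1$ set $D=\beta(\beta^{n-1}+\dots+\beta+1)$. If $k=1$, set $$I_{n,1}(\beta)=\left[\frac{1}{D},\ \frac{-\beta^{n+1}+\beta^{n}+2\beta-1}{D}\right].$$ If $k\ge 2$, write $n=qk+s$ with integers $q$ and $0\le s<k$, put $V_j=\lfloor jk/s\rfloor$ for $0\le j\le s$ and $h_j=V_j-V_{j-1}$, $W_j=\sum_{i=1}^{h_j}\beta^{(V_s-V_{j-1}-i)q+s-j}$ for $1\le j\le s$, and set $$I_{n,k}(\beta)=\left[\frac{1+\beta\left(\sum_{j=1}^{s}W_j-1\right)}{D},\ \frac{\beta\sum_{j=1}^{s}W_j-\beta^{n+1}+\beta^{n}+\beta-1}{D}\right].$$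 (This is a non-degenerate interval for $\beta<2^{1/n}$, a point for $\beta=2^{1/n}$, and empty for $\beta>2^{1/n}$.) **Statement.** Let $n\ge 2$ and $k<n$ be natural numbers with $\gcd(n,k)=1$. 1. For every integer $m\ge 2$, the set of those $\alpha\in I_{n,k}(\sqrt[n]{\beta_m})$ for which $\Omega_{\sqrt[n]{\beta_m},\alpha}$ is a subshift of finite type is dense in $I_{n,k}(\sqrt[n]{\beta_m})$. 2. For every Pisot number $\beta$, the set of those $\alpha\in I_{n,k}(\sqrt[n]{\beta})$ for which $\Omega_{\sqrt[n]{\beta},\alpha}$ is sofic is dense in $I_{n,k}(\sqrt[n]{\beta})$. -/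

import Mathlib

open Set SymbolicDynamics.FullShift

noncomputable section

/-! ### Symbolic dynamics on one-sided sequences

Sequences are indexed from `0`; the left shift `σ` is Mathlib's `shift 1`, and `σ ^ m` is
`shift m`. The finite alphabets `Fin N` carry the discrete topology and the sequence
spaces `ℕ → Fin N` the product topology. -/

/-- The word formed by the first `n` letters of `ω`. -/
def initialWord {A : Type*} (ω : ℕ → A) (n : ℕ) : List A :=
  List.ofFn fun i : Fin n => ω i

/-- `Ω` is (the underlying set of) a one-sided subshift: closed and invariant under the shift. -/
def IsSubshift {A : Type*} [TopologicalSpace A] (Ω : Set (ℕ → A)) : Prop :=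
  ∃ X : Subshift A ℕ, X.carrier = Ω

/-- Subshifts of finite type: those described by a finite set `F` of forbidden words. -/
def IsSubshiftOfFiniteType {A : Type*} [TopologicalSpace A] (Ω : Set (ℕ → A)) : Prop :=
  IsSubshift Ω ∧ ∃ F : Finset (List A),
    (∀ ν ∈ Ω, ∀ n : ℕ, 0 < n → initialWord ν n ∉ F) ∧
    (∀ ν ∉ Ω, ∃ n : ℕ, 0 < n ∧ ∃ m : ℕ, initialWord (shift m ν) n ∈ F)

/-- `Y` is a factor of `X`: there is a continuous surjection of `X` onto `Y` that commutes with
the shift. -/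
def IsFactorOf {A B : Type*} [TopologicalSpace A] [TopologicalSpace B]
    (Y : Set (ℕ → B)) (X : Set (ℕ → A)) : Prop :=
  ∃ h : (ℕ → A) → (ℕ → B), ContinuousOn h X ∧ h '' X = Y ∧
    ∀ x ∈ X, h (shift 1 x) = shift 1 (h x)

/-- Sofic subshifts: factors of subshifts of finite type over a finite alphabet. -/
def IsSofic {B : Type*} [TopologicalSpace B] (Ω : Set (ℕ → B)) : Prop :=
  IsSubshift Ω ∧ ∃ (N : ℕ) (X : Set (ℕ → Fin N)), IsSubshiftOfFiniteType X ∧ IsFactorOf Ω X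

/-! ### Intermediate `β`-transformations and `β`-shifts -/

/-- The point of discontinuity `p = (1 - α) / β`. -/
def critPt (β α : ℝ) : ℝ := (1 - α) / β

open Classical in
/-- The upper map: `β x + α` for `x < p` and `β x + α - 1` otherwise. -/
def upperMap (β α x : ℝ) : ℝ :=
  if x < critPt β α then β * x + α else β * x + α - 1

open Classical in
/-- The lower map: `β x + α` for `x ≤ p` and `β x + α - 1` otherwise. -/
def lowerMap (β α x : ℝ) : ℝ :=
  if x ≤ critPt β α then β * x + α else β * x + α - 1

open Classical in
/-- The upper expansion map. -/
def upperExpansion (β α x : ℝ) : ℕ → Fin 2 :=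
  fun n => if (upperMap β α)^[n] x < critPt β α then 0 else 1

open Classical in
/-- The lower expansion map. -/
def lowerExpansion (β α x : ℝ) : ℕ → Fin 2 :=
  fun n => if (lowerMap β α)^[n] x ≤ critPt β α then 0 else 1

/-- The interval `[-α / (β - 1), (1 - α) / (β - 1)]` on which the transformations act. -/
def betaDomain (β α : ℝ) : Set ℝ := Icc (-α / (β - 1)) ((1 - α) / (β - 1))

/-- The intermediate `β`-shift: the union of the images of the two expansion maps. -/
def betaShift (β α : ℝ) : Set (ℕ → Fin 2) :=
  upperExpansion β α '' betaDomain β α ∪ lowerExpansion β α '' betaDomain β α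

/-! ### The intervals `I_{n,k}(β)`

For `2 ≤ k` write `n = q k + s` with `0 ≤ s < k`, that is `q = n / k` and `s = n % k`. -/

/-- `V_j`, the quotient in `j k = V_j s + r_j` with `0 ≤ r_j < s`; also `V_0 = 0`. -/
def quotV (n k j : ℕ) : ℕ := j * k / (n % k)

/-- `W_j = ∑_{i = 1}^{h_j} β ^ ((V_s - V_{j-1} - i) q + s - j)` with `h_j = V_j - V_{j-1}`.
As `V_{j-1} + i ≤ V_j ≤ V_s` and `j ≤ s`, no subtraction is truncated for `1 ≤ j ≤ s`. -/
def sumW (n k : ℕ) (β : ℝ) (j : ℕ) : ℝ :=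
  ∑ i ∈ Finset.Icc 1 (quotV n k j - quotV n k (j - 1)),
    β ^ ((quotV n k (n % k) - quotV n k (j - 1) - i) * (n / k) + (n % k - j))

/-- The non-transitivity interval `I_{n,k}(β)`. -/
def nonTransInterval (n k : ℕ) (β : ℝ) : Set ℝ :=
  let D : ℝ := β * ∑ i ∈ Finset.range n, β ^ i
  let S : ℝ := ∑ j ∈ Finset.Icc 1 (n % k), sumW n k β j
  if k = 1 then
    Icc (1 / D) ((-β ^ (n + 1) + β ^ n + 2 * β - 1) / D)
  else
    Icc ((1 + β * (S - 1)) / D) ((β * S - β ^ (n + 1) + β ^ n + β - 1) / D)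

/-! ### Multinacci and Pisot numbers -/

/-- `b` is the multinacci number of order `m`: the solution of
`x ^ m = x ^ (m - 1) + ⋯ + x + 1` in `(1, 2)`. -/
def IsMultinacci (m : ℕ) (b : ℝ) : Prop :=
  1 < b ∧ b < 2 ∧ b ^ m = ∑ i ∈ Finset.range m, b ^ i

/-- A Pisot number: a real algebraic integer greater than `1` whose other Galois conjugates all
have modulus less than `1`. -/
def IsPisot (b : ℝ) : Prop :=
  IsIntegral ℤ b ∧ 1 < b ∧
    ∀ z : ℂ, Polynomial.aeval z (minpoly ℚ b) = 0 → z ≠ (b : ℂ) → ‖z‖ < 1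

end

/-- For `2 ≤ m` the multinacci number of order `m` exists and is unique. -/
theorem existsUnique_isMultinacci (m : ℕ) (hm : 2 ≤ m) : ∃! b : ℝ, IsMultinacci m b := by
  have key : ∀ x y : ℝ, IsMultinacci m x → IsMultinacci m y → ¬ x < y := by
    rintro x y ⟨hx1, -, hx⟩ ⟨hy1, -, hy⟩ hxy
    have hlt : ∑ i ∈ Finset.range m, y ^ i * x ^ m < ∑ i ∈ Finset.range m, x ^ i * y ^ m := by
      apply Finset.sum_lt_sum_of_nonempty
      · exact ⟨0, by simp; omega⟩
      · intro i hi
        have him : i < m := Finset.mem_range.mp hi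
        obtain ⟨d, rfl⟩ := Nat.exists_eq_add_of_lt him
        have h1 : x ^ (d + 1) < y ^ (d + 1) :=
          pow_lt_pow_left₀ hxy (by linarith) (by omega)
        have h2 : 0 < x ^ i * y ^ i := by positivity
        have e1 : y ^ i * x ^ (i + d + 1) = x ^ i * y ^ i * x ^ (d + 1) := by ring
        have e2 : x ^ i * y ^ (i + d + 1) = x ^ i * y ^ i * y ^ (d + 1) := by ring
        rw [e1, e2]
        exact mul_lt_mul_of_pos_left h1 h2
    rw [← Finset.sum_mul, ← Finset.sum_mul, ← hx, ← hy, mul_comm] at hlt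
    exact lt_irrefl _ hlt
  have hcont : ContinuousOn (fun x : ℝ => ∑ i ∈ Finset.range m, x ^ i - x ^ m) (Icc 1 2) := by
    fun_prop
  have h0 : (0 : ℝ) ∈ Ioo (∑ i ∈ Finset.range m, (2 : ℝ) ^ i - 2 ^ m)
      (∑ i ∈ Finset.range m, (1 : ℝ) ^ i - 1 ^ m) := by
    have hm' : (2 : ℝ) ≤ m := by exact_mod_cast hm
    constructor
    · rw [geom_sum_eq (by norm_num)]
      norm_num
    · simp
      linarith
  obtain ⟨b, ⟨hb1, hb2⟩, hb⟩ := intermediate_value_Ioo' (by norm_num) hcont h0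
  have hbm : IsMultinacci m b := ⟨hb1, hb2, by simp only at hb; linarith⟩
  refine ⟨b, hbm, fun y hy => ?_⟩
  exact le_antisymm (not_lt.mp (key b y hbm hy)) (not_lt.mp (key y b hy hbm))

/-! Write b = β ^ n with b multinacci or Pisot, and p for the critical point. The proof
renormalises. For α in I_{n,k}(β) there is an interval [u, v] around p that the n-th iterates of
both maps carry into itself, and an affine chart turns these return maps into the two maps on [0, 1]
with base b and a parameter a = `renormParam n k β α` (`upperMap_iterate_chart`,
`lowerMap_iterate_chart`). The chart matches the critical points, a is affine in α, and I_{n,k}(β)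
is exactly the preimage of [0, 2 - b] (`mem_nonTransInterval_iff`). So periodic or finite critical
orbits for (b, a) give the same for (β, α), and density in [0, 2 - b] passes to I_{n,k}(β).

The interval [u, v] comes from `renormOrder`: the intervals on its itinerary lie on the line in the
order of a rotation by k / n, because gaps between neighbours expand at most by β along the rotation
and hence cannot be negative.

On the symbolic side, the shift consists of all sequences between lexicographic bounds given by the
two expansions of p (`betaShift_eq_admissible`). Periodic bounds give finite type; bounds with
finite shift orbits give a sofic shift.

Density for base b: if b is multinacci, (2 - b) b ^ m = 1 makes both orbits of p merge at a b ^ m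
after m + 1 steps, so both are periodic once the merged orbit hits p. Were p missed for all a in an
open interval, the j-th orbit point would be affine in a with slope at least b ^ j, yet stay in [0,
1]. If b is Pisot, every rational a works: after clearing the denominator, the orbits consist of
algebraic integers of ℚ(b) that are bounded in all embeddings. -/

/-! ### Subshifts given by local conditions -/

/-- The sequences all of whose shifts satisfy the conditions `Q N`. -/
def localShift {A : Type*} (Q : ℕ → (ℕ → A) → Prop) : Set (ℕ → A) :=
  {ω | ∀ n N, Q N (shift n ω)}

theorem shift_shift {A : Type*} (m n : ℕ) (ω : ℕ → A) :
    shift m (shift n ω) = shift (n + m) ω := by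
  ext i
  simp [add_assoc]

/-- Each condition sees finitely many coordinates, so a violation persists on a cylinder; this gives
closedness. -/
theorem isSubshift_localShift {A : Type*} [TopologicalSpace A] [DiscreteTopology A]
    (Q : ℕ → (ℕ → A) → Prop)
    (hQ : ∀ N ω ω', (∀ i < N, ω i = ω' i) → Q N ω → Q N ω') : IsSubshift (localShift Q) := by
  refine ⟨⟨localShift Q, ?_, ?_⟩, rfl⟩
  · rw [← isOpen_compl_iff, isOpen_iff_mem_nhds]
    intro ω hω
    obtain ⟨n, N, h⟩ : ∃ n N, ¬ Q N (shift n ω) := by simpa [localShift] using hω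
    refine Filter.mem_of_superset
      ((isOpen_cylinder (Finset.range (n + N)) ω).mem_nhds fun i _ => rfl) ?_
    intro ω' hω' hmem
    refine h (hQ N _ _ (fun i hi => ?_) (hmem n N))
    exact hω' (n + i) (by simpa using hi)
  · intro m ω hω n N
    rw [shift_shift]
    exact hω _ _

theorem initialWord_eq_iff {A : Type*} {ω ω' : ℕ → A} {n : ℕ} :
    initialWord ω n = initialWord ω' n ↔ ∀ i < n, ω i = ω' i := by
  unfold initialWord
  rw [List.ofFn_inj, funext_iff]
  exact ⟨fun h i hi => h ⟨i, hi⟩, fun h i => h i i.2⟩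

theorem isSubshiftOfFiniteType_of_local {A : Type*} [TopologicalSpace A] [DiscreteTopology A]
    [Finite A] (N : ℕ) (hN : 0 < N) (Q : (ℕ → A) → Prop)
    (hQ : ∀ ω ω', (∀ i < N, ω i = ω' i) → Q ω → Q ω') :
    IsSubshiftOfFiniteType {ω | ∀ n, Q (shift n ω)} := by
  have hfin : {l : List A | ∃ ω, ¬ Q ω ∧ initialWord ω N = l}.Finite := by
    refine (Set.finite_range (fun w : Fin N → A => List.ofFn w)).subset ?_
    rintro _ ⟨ω, -, rfl⟩
    exact ⟨fun i => ω i, rfl⟩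
  refine ⟨?_, hfin.toFinset, ?_, ?_⟩
  · have := isSubshift_localShift (fun M ω => M = N → Q ω) (by
      rintro M ω ω' h h1 rfl
      exact hQ ω ω' h (h1 rfl))
    convert this using 1
    ext ω
    simp [localShift]
  · intro ν hν n _ hmem
    obtain ⟨ω, hω, h⟩ := hfin.mem_toFinset.1 hmem
    obtain rfl : N = n := by simpa [initialWord] using congrArg List.length h
    have h0 := hν 0
    rw [shift_zero] at h0
    exact hω (hQ ν ω (fun i hi => (initialWord_eq_iff.1 h i hi).symm) h0)
  · intro ν hν
    obtain ⟨m, hm⟩ : ∃ m, ¬ Q (shift m ν) := by simpa using hν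
    exact ⟨N, hN, m, hfin.mem_toFinset.2 ⟨_, hm, rfl⟩⟩

/-! ### The lexicographic order -/

/-- The lexicographic order on binary sequences. -/
def LexLe (x y : ℕ → Fin 2) : Prop :=
  ∀ j, (∀ i < j, x i = y i) → x j ≤ y j

/-- Coinduction: as long as the letters agree, `R` survives the shift, so the first difference can
be moved to the front. -/
theorem lexLe_of_coinductive (R : (ℕ → Fin 2) → (ℕ → Fin 2) → Prop)
    (hR : ∀ x y, R x y → x 0 ≤ y 0 ∧ (x 0 = y 0 → R (shift 1 x) (shift 1 y)))
    {x y : ℕ → Fin 2} (h : R x y) : LexLe x y := by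
  intro j
  induction j generalizing x y with
  | zero => exact fun _ => (hR x y h).1
  | succ j ih =>
    intro hj
    have := ih ((hR x y h).2 (hj 0 (by omega))) fun i hi => by
      simpa [add_comm] using hj (i + 1) (by omega)
    simpa [add_comm] using this

theorem LexLe.head {x y : ℕ → Fin 2} (h : LexLe x y) : x 0 ≤ y 0 :=
  h 0 fun i hi => absurd hi (by omega)

theorem LexLe.tail {x y : ℕ → Fin 2} (h : LexLe x y) (h0 : x 0 = y 0) :
    LexLe (shift 1 x) (shift 1 y) := by
  intro j hj
  have := h (j + 1) fun i hi => by
    rcases i with _ | i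
    · exact h0
    · simpa [add_comm] using hj i (by omega)
  simpa [add_comm] using this

theorem LexLe.exists_lt_of_ne {x y : ℕ → Fin 2} (h : LexLe x y) (hne : x ≠ y) :
    ∃ j, (∀ i < j, x i = y i) ∧ x j = 0 ∧ y j = 1 := by
  classical
  have hex : ∃ j, x j ≠ y j := by
    by_contra! hc
    exact hne (funext hc)
  refine ⟨Nat.find hex, fun i hi => not_not.1 (Nat.find_min hex hi), ?_⟩
  have h1 := h (Nat.find hex) fun i hi => not_not.1 (Nat.find_min hex hi)
  have h2 := Nat.find_spec hex
  omega

/-- The sequences whose shifts starting with `0` are at most `a` and whose shifts starting with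
`1` are at least `b`. -/
def admissible (a b : ℕ → Fin 2) : Set (ℕ → Fin 2) :=
  {ω | ∀ n, (ω n = 0 → LexLe (shift n ω) a) ∧ (ω n = 1 → LexLe b (shift n ω))}

theorem shift_mem_admissible {a b ω : ℕ → Fin 2} (h : ω ∈ admissible a b) (m : ℕ) :
    shift m ω ∈ admissible a b := by
  intro n
  rw [shift_shift]
  exact h (m + n)

/-- The part of the admissibility condition that concerns the first `N` letters. -/
def admissibleUpTo (a b : ℕ → Fin 2) (N : ℕ) (ω : ℕ → Fin 2) : Prop :=
  ∀ j < N, (ω 0 = 0 → (∀ i < j, ω i = a i) → ω j ≤ a j) ∧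
    (ω 0 = 1 → (∀ i < j, b i = ω i) → b j ≤ ω j)

theorem admissibleUpTo_congr (a b : ℕ → Fin 2) (N : ℕ) (ω ω' : ℕ → Fin 2)
    (h : ∀ i < N, ω i = ω' i) (hω : admissibleUpTo a b N ω) : admissibleUpTo a b N ω' := by
  intro j hj
  have h0 := h 0 (by omega)
  have hj' := h j hj
  obtain ⟨h1, h2⟩ := hω j hj
  rw [← h0, ← hj']
  refine ⟨fun h3 h4 => h1 h3 fun i hi => ?_, fun h3 h4 => h2 h3 fun i hi => ?_⟩
  · rw [h i (by omega), h4 i hi]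
  · rw [h i (by omega), h4 i hi]

theorem admissible_eq_localShift (a b : ℕ → Fin 2) :
    admissible a b = localShift (admissibleUpTo a b) := by
  ext ω
  constructor
  · intro h n N j _
    exact ⟨fun h0 => (h n).1 (by simpa using h0) j, fun h0 => (h n).2 (by simpa using h0) j⟩
  · intro h n
    exact ⟨fun h0 j => (h n (j + 1) j (by omega)).1 (by simpa using h0),
      fun h0 j => (h n (j + 1) j (by omega)).2 (by simpa using h0)⟩

theorem isSubshift_admissible (a b : ℕ → Fin 2) : IsSubshift (admissible a b) := by
  rw [admissible_eq_localShift]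
  exact isSubshift_localShift _ (admissibleUpTo_congr a b)

/-- The admissible sequences form a subshift of finite type when both bounds are periodic. -/
theorem isSubshiftOfFiniteType_admissible {a b : ℕ → Fin 2} {P P' : ℕ} (hP : 0 < P)
    (hP' : 0 < P') (ha : shift P a = a) (hb : shift P' b = b) :
    IsSubshiftOfFiniteType (admissible a b) := by
  have key : admissible a b =
      {ω | ∀ n, admissibleUpTo a b (max P P' + 1) (shift n ω)} := by
    ext ω
    constructor
    · intro h n
      rw [admissible_eq_localShift] at h
      exact h n _
    · intro h n
      have ha' : ∀ i, a (P + i) = a i := fun i => congrFun ha i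
      have hb' : ∀ i, b (P' + i) = b i := fun i => congrFun hb i
      constructor
      · intro h0 j
        induction j using Nat.strong_induction_on generalizing n with
        | _ j ih =>
          intro hj
          by_cases hjP : j ≤ P
          · exact (h n j (by omega)).1 (by simpa using h0) hj
          -- After agreement along a full period, the sequence shifted by `P` again starts with `0`
          -- and agrees with `a` on a shorter prefix, so longer windows impose nothing new.
          · obtain ⟨d, rfl⟩ := Nat.exists_eq_add_of_lt (not_le.1 hjP)
            have e0 := hj 0 (by omega)
            have eP := hj P (by omega)
            have := ih (d + 1) (by omega) (n + P) (by
              have := ha' 0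
              simp_all) fun i hi => by
                have := hj (P + i) (by omega)
                rw [ha'] at this
                simpa [add_assoc] using this
            rw [add_assoc P d 1, ha']
            simpa [add_assoc] using this
      · intro h0 j
        induction j using Nat.strong_induction_on generalizing n with
        | _ j ih =>
          intro hj
          by_cases hjP : j ≤ P'
          · exact (h n j (by omega)).2 (by simpa using h0) hj
          · obtain ⟨d, rfl⟩ := Nat.exists_eq_add_of_lt (not_le.1 hjP)
            have e0 := hj 0 (by omega)
            have eP := hj P' (by omega)
            have := ih (d + 1) (by omega) (n + P') (by
              have := hb' 0
              simp_all) fun i hi => by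
                have := hj (P' + i) (by omega)
                rw [hb'] at this
                simpa [add_assoc] using this
            rw [add_assoc P' d 1, hb']
            simpa [add_assoc] using this
  rw [key]
  exact isSubshiftOfFiniteType_of_local _ (by omega) _ (admissibleUpTo_congr a b _)

/-! ### Sofic presentation -/

section Sofic

variable {a b : ℕ → Fin 2}

/-- A letter together with a set of pending upper bounds and a set of pending lower bounds for
the sequence that starts with this letter. -/
abbrev BoundState (a b : ℕ → Fin 2) : Type :=
  Fin 2 × Set (range fun i => shift i a) × Set (range fun i => shift i b)

/-- The transition rule between bound states. -/
def boundStep (s t : BoundState a b) : Prop :=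
  (s.1 = 0 → ∃ q ∈ s.2.1, q.1 = a) ∧ (s.1 = 1 → ∃ q ∈ s.2.2, q.1 = b) ∧
  (∀ q ∈ s.2.1, s.1 ≤ q.1 0 ∧ (s.1 = q.1 0 → ∃ q' ∈ t.2.1, q'.1 = shift 1 q.1)) ∧
  (∀ q ∈ s.2.2, q.1 0 ≤ s.1 ∧ (q.1 0 = s.1 → ∃ q' ∈ t.2.2, q'.1 = shift 1 q.1))

theorem lexLe_of_boundStep {x : ℕ → BoundState a b} (hx : ∀ n, boundStep (x n) (x (n + 1)))
    {n : ℕ} {q : range fun i => shift i a} (hq : q ∈ (x n).2.1) :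
    LexLe (fun i => (x (n + i)).1) q.1 := by
  refine lexLe_of_coinductive
    (fun ω c => ∃ n, ∃ q ∈ (x n).2.1, ω = (fun i => (x (n + i)).1) ∧ c = q.1) ?_
    ⟨n, q, hq, rfl, rfl⟩
  rintro _ _ ⟨n, q, hq, rfl, rfl⟩
  obtain ⟨h1, h2⟩ := (hx n).2.2.1 q hq
  refine ⟨h1, fun h => ?_⟩
  obtain ⟨q', hq', e⟩ := h2 h
  exact ⟨n + 1, q', hq', by ext i; simp [add_assoc], e.symm⟩

theorem lexLe_of_boundStep' {x : ℕ → BoundState a b} (hx : ∀ n, boundStep (x n) (x (n + 1)))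
    {n : ℕ} {q : range fun i => shift i b} (hq : q ∈ (x n).2.2) :
    LexLe q.1 (fun i => (x (n + i)).1) := by
  refine lexLe_of_coinductive
    (fun c ω => ∃ n, ∃ q ∈ (x n).2.2, ω = (fun i => (x (n + i)).1) ∧ c = q.1) ?_
    ⟨n, q, hq, rfl, rfl⟩
  rintro _ _ ⟨n, q, hq, rfl, rfl⟩
  obtain ⟨h1, h2⟩ := (hx n).2.2.2 q hq
  refine ⟨h1, fun h => ?_⟩
  obtain ⟨q', hq', e⟩ := h2 h
  exact ⟨n + 1, q', hq', by ext i; simp [add_assoc], e.symm⟩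

/-- Each letter must itself list `a` or `b` as pending, and a pending bound is either strictly
satisfied at once or handed on, shifted, to the next state. Hence every bound holds along the whole
path. -/
theorem admissible_of_boundStep {x : ℕ → BoundState a b}
    (hx : ∀ n, boundStep (x n) (x (n + 1))) : (fun i => (x i).1) ∈ admissible a b := by
  intro n
  constructor
  · intro h
    obtain ⟨q, hq, e⟩ := (hx n).1 h
    exact e.subst (motive := LexLe _) (lexLe_of_boundStep hx hq)
  · intro h
    obtain ⟨q, hq, e⟩ := (hx n).2.1 h
    exact e.subst (motive := fun c => LexLe c _) (lexLe_of_boundStep' hx hq)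

/-- The canonical path lists at each time all shifts of `a` and of `b` that do bound the current
tail. -/
theorem exists_boundStep_of_admissible {ω : ℕ → Fin 2} (hω : ω ∈ admissible a b) :
    ∃ x : ℕ → BoundState a b, (∀ n, boundStep (x n) (x (n + 1))) ∧ (fun i => (x i).1) = ω := by
  refine ⟨fun n => (ω n, {q | LexLe (shift n ω) q.1}, {q | LexLe q.1 (shift n ω)}), ?_, rfl⟩
  have hmem : ∀ {c : ℕ → Fin 2} (q : range fun i => shift i c),
      shift 1 q.1 ∈ range fun i => shift i c := by
    rintro c ⟨_, i, rfl⟩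
    exact ⟨i + 1, (shift_shift 1 i c).symm⟩
  intro n
  refine ⟨fun h => ⟨⟨a, 0, shift_zero a⟩, (hω n).1 h, rfl⟩,
    fun h => ⟨⟨b, 0, shift_zero b⟩, (hω n).2 h, rfl⟩, fun q hq => ⟨hq.head, fun h => ?_⟩,
    fun q hq => ⟨hq.head, fun h => ?_⟩⟩
  · refine ⟨⟨_, hmem q⟩, ?_, rfl⟩
    have := hq.tail h
    rwa [shift_shift] at this
  · refine ⟨⟨_, hmem q⟩, ?_, rfl⟩
    have := hq.tail h
    rwa [shift_shift] at this

/-- The admissible sequences form a sofic shift when both bounds have finite shift orbits. -/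
theorem isSofic_admissible (ha : (range fun i => shift i a).Finite)
    (hb : (range fun i => shift i b).Finite) : IsSofic (admissible a b) := by
  refine ⟨isSubshift_admissible a b, ?_⟩
  have := ha.to_subtype
  have := hb.to_subtype
  -- Finite orbits make the set of states finite, so the states serve as alphabet. The transition
  -- rule involves two consecutive states, hence the window `2` below.
  obtain ⟨N, ⟨e⟩⟩ := Finite.exists_equiv_fin (BoundState a b)
  refine ⟨N, {x | ∀ n, boundStep (e.symm (shift n x 0)) (e.symm (shift n x 1))},
    isSubshiftOfFiniteType_of_local 2 (by omega)
      (fun x => boundStep (e.symm (x 0)) (e.symm (x 1))) ?_,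
    fun x i => (e.symm (x i)).1, ?_, ?_, fun x _ => rfl⟩
  · intro x x' h h1
    rwa [← h 0 (by omega), ← h 1 (by omega)]
  · refine Continuous.continuousOn (continuous_pi fun i => ?_)
    exact (continuous_of_discreteTopology (f := fun s => (e.symm s).1)).comp (continuous_apply i)
  · apply Subset.antisymm
    · rintro _ ⟨x, hx, rfl⟩
      exact admissible_of_boundStep (x := fun i => e.symm (x i)) fun n => by simpa using hx n
    · intro ω hω
      obtain ⟨x, hx, rfl⟩ := exists_boundStep_of_admissible hω
      exact ⟨fun i => e (x i), fun n => by simpa using hx n, by simp⟩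

end Sofic

/-! ### The real number represented by a binary sequence -/

section Value

variable {β α : ℝ}

/-- The `β`-expansion value `∑ ωᵢ β ^ (-(i + 1))`. -/
noncomputable def betaValue (β : ℝ) (ω : ℕ → Fin 2) : ℝ :=
  ∑' i, ((ω i : ℕ) : ℝ) * β⁻¹ ^ (i + 1)

theorem digit_mem_Icc (c : Fin 2) : ((c : ℕ) : ℝ) ∈ Icc (0 : ℝ) 1 :=
  ⟨by positivity, by exact_mod_cast Nat.lt_succ_iff.1 c.2⟩

theorem hasSum_inv_pow_succ (hβ : 1 < β) :
    HasSum (fun i : ℕ => β⁻¹ ^ (i + 1)) (1 / (β - 1)) := by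
  have h1 : β⁻¹ < 1 := inv_lt_one_of_one_lt₀ hβ
  have h0 : 0 ≤ β⁻¹ := by positivity
  have := (hasSum_geometric_of_lt_one h0 h1).mul_left β⁻¹
  have e : β⁻¹ * (1 - β⁻¹)⁻¹ = 1 / (β - 1) := by
    have : β - 1 ≠ 0 := by linarith
    have : β ≠ 0 := by linarith
    field_simp
  rw [e] at this
  simpa only [pow_succ'] using this

theorem summable_betaValue (hβ : 1 < β) (ω : ℕ → Fin 2) :
    Summable fun i => ((ω i : ℕ) : ℝ) * β⁻¹ ^ (i + 1) := by
  have h0 : 0 < β⁻¹ := by positivity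
  refine Summable.of_nonneg_of_le (fun i => ?_) (fun i => ?_) (hasSum_inv_pow_succ hβ).summable
  · exact mul_nonneg (digit_mem_Icc _).1 (by positivity)
  · exact mul_le_of_le_one_left (by positivity) (digit_mem_Icc _).2

theorem betaValue_mem_Icc (hβ : 1 < β) (ω : ℕ → Fin 2) :
    betaValue β ω ∈ Icc 0 (1 / (β - 1)) := by
  have h0 : 0 < β⁻¹ := by positivity
  constructor
  · exact tsum_nonneg fun i => mul_nonneg (digit_mem_Icc _).1 (by positivity)
  · rw [← (hasSum_inv_pow_succ hβ).tsum_eq]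
    exact (summable_betaValue hβ ω).tsum_le_tsum
      (fun i => mul_le_of_le_one_left (by positivity) (digit_mem_Icc _).2)
      (hasSum_inv_pow_succ hβ).summable

theorem betaValue_shift (hβ : 1 < β) (ω : ℕ → Fin 2) :
    betaValue β (shift 1 ω) = β * betaValue β ω - (ω 0 : ℕ) := by
  have hne : β ≠ 0 := by linarith
  unfold betaValue
  rw [(summable_betaValue hβ ω).tsum_eq_zero_add, mul_add, ← tsum_mul_left]
  have : ∀ i, β * (((ω (i + 1) : ℕ) : ℝ) * β⁻¹ ^ (i + 1 + 1)) =
      (((shift 1 ω i : Fin 2) : ℕ) : ℝ) * β⁻¹ ^ (i + 1) := by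
    intro i
    rw [shift_apply, add_comm 1 i, pow_succ _ (i + 1)]
    field_simp
  simp_rw [this]
  rw [zero_add, pow_one, mul_left_comm, mul_inv_cancel₀ hne]
  ring

/-- The point of the domain of the `β`-transformation that has the expansion `ω`. -/
noncomputable def expansionPoint (β α : ℝ) (ω : ℕ → Fin 2) : ℝ :=
  betaValue β ω - α / (β - 1)

theorem expansionPoint_mem (hβ : 1 < β) (ω : ℕ → Fin 2) :
    expansionPoint β α ω ∈ betaDomain β α := by
  obtain ⟨h1, h2⟩ := betaValue_mem_Icc hβ ω
  unfold betaDomain expansionPoint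
  rw [sub_div, neg_div]
  exact ⟨by linarith, by linarith⟩

theorem expansionPoint_shift (hβ : 1 < β) (ω : ℕ → Fin 2) :
    expansionPoint β α (shift 1 ω) = β * expansionPoint β α ω + α - (ω 0 : ℕ) := by
  have : β - 1 ≠ 0 := by linarith
  unfold expansionPoint
  rw [betaValue_shift hβ]
  field_simp
  ring

theorem expansionPoint_shift_succ (hβ : 1 < β) (ω : ℕ → Fin 2) (n : ℕ) :
    expansionPoint β α (shift (n + 1) ω) =
      β * expansionPoint β α (shift n ω) + α - (ω n : ℕ) := by
  rw [← shift_shift 1 n, expansionPoint_shift hβ]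
  simp

/-- A bounded orbit with digits `ω` starts at the point with expansion `ω`. -/
theorem eq_expansionPoint_of_bounded (hβ : 1 < β) {ω : ℕ → Fin 2} {x : ℕ → ℝ}
    (hx : ∀ n, x (n + 1) = β * x n + α - (ω n : ℕ)) (hb : ∀ n, x n ∈ betaDomain β α) (n : ℕ) :
    x n = expansionPoint β α (shift n ω) := by
  -- Two orbits with the same digits separate by the factor `β` at each step, which a bounded domain
  -- allows only if they coincide.
  have hgrow : ∀ j, x (n + j) - expansionPoint β α (shift (n + j) ω) =
      β ^ j * (x n - expansionPoint β α (shift n ω)) := by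
    intro j
    induction j with
    | zero => simp
    | succ j ih =>
      rw [← add_assoc, hx, expansionPoint_shift_succ hβ, pow_succ', mul_assoc, ← ih]
      ring
  by_contra hne
  have hpos : 0 < |x n - expansionPoint β α (shift n ω)| := abs_pos.2 (sub_ne_zero.2 hne)
  obtain ⟨j, hj⟩ := pow_unbounded_of_one_lt
    (((1 - α) / (β - 1) - -α / (β - 1)) / |x n - expansionPoint β α (shift n ω)|) hβ
  rw [div_lt_iff₀ hpos, ← abs_of_pos (show 0 < β ^ j by positivity), ← abs_mul, ← hgrow] at hj
  obtain ⟨h1, h2⟩ := hb (n + j)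
  obtain ⟨h3, h4⟩ := expansionPoint_mem (α := α) hβ (shift (n + j) ω)
  rcases abs_cases (x (n + j) - expansionPoint β α (shift (n + j) ω)) with h | h <;> linarith

theorem expansionPoint_sub_of_agree (hβ : 1 < β) {ω c : ℕ → Fin 2} {j : ℕ}
    (h : ∀ i < j, ω i = c i) :
    expansionPoint β α (shift j ω) - expansionPoint β α (shift j c) =
      β ^ j * (expansionPoint β α ω - expansionPoint β α c) := by
  induction j with
  | zero => simp
  | succ j ih =>
    rw [expansionPoint_shift_succ hβ, expansionPoint_shift_succ hβ, pow_succ', mul_assoc,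
      ← ih fun i hi => h i (by omega), h j (by omega)]
    ring

end Value

/-! ### Expansions as admissible sequences -/

section Expansion

variable {β α : ℝ}

theorem upperExpansion_eq_zero_iff {x : ℝ} {n : ℕ} :
    upperExpansion β α x n = 0 ↔ (upperMap β α)^[n] x < critPt β α := by
  simp [upperExpansion]

theorem upperExpansion_eq_one_iff {x : ℝ} {n : ℕ} :
    upperExpansion β α x n = 1 ↔ critPt β α ≤ (upperMap β α)^[n] x := by
  simp [upperExpansion]

theorem lowerExpansion_eq_zero_iff {x : ℝ} {n : ℕ} :
    lowerExpansion β α x n = 0 ↔ (lowerMap β α)^[n] x ≤ critPt β α := by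
  simp [lowerExpansion]

theorem lowerExpansion_eq_one_iff {x : ℝ} {n : ℕ} :
    lowerExpansion β α x n = 1 ↔ critPt β α < (lowerMap β α)^[n] x := by
  simp [lowerExpansion]

theorem shift_upperExpansion (n : ℕ) (x : ℝ) :
    shift n (upperExpansion β α x) = upperExpansion β α ((upperMap β α)^[n] x) := by
  ext i
  simp [upperExpansion, ← Function.iterate_add_apply, add_comm]

theorem shift_lowerExpansion (n : ℕ) (x : ℝ) :
    shift n (lowerExpansion β α x) = lowerExpansion β α ((lowerMap β α)^[n] x) := by
  ext i
  simp [lowerExpansion, ← Function.iterate_add_apply, add_comm]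

theorem upperMap_eq_digit (x : ℝ) :
    upperMap β α x = β * x + α - (upperExpansion β α x 0 : ℕ) := by
  by_cases h : x < critPt β α <;> simp [upperMap, upperExpansion, h]

theorem lowerMap_eq_digit (x : ℝ) :
    lowerMap β α x = β * x + α - (lowerExpansion β α x 0 : ℕ) := by
  by_cases h : x ≤ critPt β α <;> simp [lowerMap, lowerExpansion, h]

theorem upperMap_iterate_succ (x : ℝ) (n : ℕ) : (upperMap β α)^[n + 1] x =
    β * (upperMap β α)^[n] x + α - (upperExpansion β α x n : ℕ) := by
  rw [Function.iterate_succ_apply', upperMap_eq_digit, ← shift_upperExpansion]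
  simp

theorem lowerMap_iterate_succ (x : ℝ) (n : ℕ) : (lowerMap β α)^[n + 1] x =
    β * (lowerMap β α)^[n] x + α - (lowerExpansion β α x n : ℕ) := by
  rw [Function.iterate_succ_apply', lowerMap_eq_digit, ← shift_lowerExpansion]
  simp

theorem critPt_mem (hβ : 1 < β) (hα0 : 0 ≤ α) (hα1 : α ≤ 2 - β) :
    critPt β α ∈ betaDomain β α := by
  have h1 : 0 < β - 1 := by linarith
  have h2 : 0 < β := by linarith
  unfold critPt betaDomain
  constructor
  · rw [div_le_div_iff₀ h1 h2]
    nlinarith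
  · rw [div_le_div_iff₀ h2 h1]
    nlinarith

theorem mem_betaDomain_of_digit (hβ : 1 < β) (hα0 : 0 ≤ α) (hα1 : α ≤ 2 - β) {x : ℝ}
    (hx : x ∈ betaDomain β α) {c : Fin 2} (h0 : c = 0 → x ≤ critPt β α)
    (h1 : c = 1 → critPt β α ≤ x) : β * x + α - (c : ℕ) ∈ betaDomain β α := by
  have hb1 : 0 < β - 1 := by linarith
  have hb2 : 0 < β := by linarith
  unfold critPt at h0 h1
  obtain ⟨h3, h4⟩ := hx
  rw [div_le_iff₀ hb1] at h3
  rw [le_div_iff₀ hb1] at h4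
  unfold betaDomain
  rw [mem_Icc, div_le_iff₀ hb1, le_div_iff₀ hb1]
  have hc : c = 0 ∨ c = 1 := by omega
  rcases hc with rfl | rfl
  · have := h0 rfl
    rw [le_div_iff₀ hb2] at this
    constructor <;> norm_num <;> nlinarith
  · have := h1 rfl
    rw [div_le_iff₀ hb2] at this
    constructor <;> norm_num <;> nlinarith

theorem upperMap_iterate_mem (hβ : 1 < β) (hα0 : 0 ≤ α) (hα1 : α ≤ 2 - β) {x : ℝ}
    (hx : x ∈ betaDomain β α) (n : ℕ) : (upperMap β α)^[n] x ∈ betaDomain β α := by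
  induction n with
  | zero => exact hx
  | succ n ih =>
    rw [upperMap_iterate_succ]
    exact mem_betaDomain_of_digit hβ hα0 hα1 ih (fun h => (upperExpansion_eq_zero_iff.1 h).le)
      upperExpansion_eq_one_iff.1

theorem lowerMap_iterate_mem (hβ : 1 < β) (hα0 : 0 ≤ α) (hα1 : α ≤ 2 - β) {x : ℝ}
    (hx : x ∈ betaDomain β α) (n : ℕ) : (lowerMap β α)^[n] x ∈ betaDomain β α := by
  induction n with
  | zero => exact hx
  | succ n ih =>
    rw [lowerMap_iterate_succ]
    exact mem_betaDomain_of_digit hβ hα0 hα1 ih lowerExpansion_eq_zero_iff.1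
      (fun h => (lowerExpansion_eq_one_iff.1 h).le)

theorem lexLe_upper_upper (hβ : 1 < β) {x y : ℝ} (h : x ≤ y) :
    LexLe (upperExpansion β α x) (upperExpansion β α y) := by
  refine lexLe_of_coinductive
    (fun u v => ∃ x y, x ≤ y ∧ u = upperExpansion β α x ∧ v = upperExpansion β α y) ?_
    ⟨x, y, h, rfl, rfl⟩
  rintro _ _ ⟨x, y, h, rfl, rfl⟩
  refine ⟨?_, fun he => ⟨_, _, ?_, shift_upperExpansion 1 x, shift_upperExpansion 1 y⟩⟩
  · by_cases hy : y < critPt β α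
    · simp [upperExpansion, hy, h.trans_lt hy]
    · simp only [upperExpansion, Function.iterate_zero, id, hy, if_false]
      exact Fin.le_last _
  · simp only [Function.iterate_one, upperMap_eq_digit, he]
    nlinarith

theorem lexLe_lower_lower (hβ : 1 < β) {x y : ℝ} (h : x ≤ y) :
    LexLe (lowerExpansion β α x) (lowerExpansion β α y) := by
  refine lexLe_of_coinductive
    (fun u v => ∃ x y, x ≤ y ∧ u = lowerExpansion β α x ∧ v = lowerExpansion β α y) ?_
    ⟨x, y, h, rfl, rfl⟩
  rintro _ _ ⟨x, y, h, rfl, rfl⟩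
  refine ⟨?_, fun he => ⟨_, _, ?_, shift_lowerExpansion 1 x, shift_lowerExpansion 1 y⟩⟩
  · by_cases hy : y ≤ critPt β α
    · simp [lowerExpansion, hy, h.trans hy]
    · simp only [lowerExpansion, Function.iterate_zero, id, hy, if_false]
      exact Fin.le_last _
  · simp only [Function.iterate_one, lowerMap_eq_digit, he]
    nlinarith

theorem lexLe_upper_lower (hβ : 1 < β) {x y : ℝ} (h : x < y) :
    LexLe (upperExpansion β α x) (lowerExpansion β α y) := by
  refine lexLe_of_coinductive
    (fun u v => ∃ x y, x < y ∧ u = upperExpansion β α x ∧ v = lowerExpansion β α y) ?_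
    ⟨x, y, h, rfl, rfl⟩
  rintro _ _ ⟨x, y, h, rfl, rfl⟩
  refine ⟨?_, fun he => ⟨_, _, ?_, shift_upperExpansion 1 x, shift_lowerExpansion 1 y⟩⟩
  · by_cases hy : y ≤ critPt β α
    · simp [upperExpansion, lowerExpansion, hy, h.trans_le hy]
    · simp only [lowerExpansion, Function.iterate_zero, id, hy, if_false]
      exact Fin.le_last _
  · simp only [Function.iterate_one, upperMap_eq_digit, lowerMap_eq_digit, he]
    nlinarith

theorem betaShift_subset_admissible (hβ : 1 < β) : betaShift β α ⊆
    admissible (lowerExpansion β α (critPt β α)) (upperExpansion β α (critPt β α)) := by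
  rintro _ (⟨x, -, rfl⟩ | ⟨x, -, rfl⟩) n
  · rw [shift_upperExpansion]
    exact ⟨fun h => lexLe_upper_lower hβ (upperExpansion_eq_zero_iff.1 h),
      fun h => lexLe_upper_upper hβ (upperExpansion_eq_one_iff.1 h)⟩
  · rw [shift_lowerExpansion]
    exact ⟨fun h => lexLe_lower_lower hβ (lowerExpansion_eq_zero_iff.1 h),
      fun h => lexLe_upper_lower hβ (lowerExpansion_eq_one_iff.1 h)⟩

theorem expansionPoint_shift_lowerExpansion (hβ : 1 < β) (hα0 : 0 ≤ α) (hα1 : α ≤ 2 - β)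
    {x : ℝ} (hx : x ∈ betaDomain β α) (n : ℕ) :
    expansionPoint β α (shift n (lowerExpansion β α x)) = (lowerMap β α)^[n] x :=
  (eq_expansionPoint_of_bounded hβ (lowerMap_iterate_succ x)
    (lowerMap_iterate_mem hβ hα0 hα1 hx) n).symm

theorem expansionPoint_shift_upperExpansion (hβ : 1 < β) (hα0 : 0 ≤ α) (hα1 : α ≤ 2 - β)
    {x : ℝ} (hx : x ∈ betaDomain β α) (n : ℕ) :
    expansionPoint β α (shift n (upperExpansion β α x)) = (upperMap β α)^[n] x :=
  (eq_expansionPoint_of_bounded hβ (upperMap_iterate_succ x)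
    (upperMap_iterate_mem hβ hα0 hα1 hx) n).symm

/-- An admissible sequence represents a point on the side of the critical point that is
prescribed by its first letter. -/
theorem expansionPoint_le_critPt (hβ : 1 < β) (hα0 : 0 ≤ α) (hα1 : α ≤ 2 - β)
    {ω : ℕ → Fin 2}
    (hω : ω ∈ admissible (lowerExpansion β α (critPt β α)) (upperExpansion β α (critPt β α)))
    (n : ℕ) :
    (ω n = 0 → expansionPoint β α (shift n ω) ≤ critPt β α) ∧
      (ω n = 1 → critPt β α ≤ expansionPoint β α (shift n ω)) := by
  have hp := critPt_mem hβ hα0 hα1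
  have hβ0 : 0 < β := by linarith
  set C := (1 - α) / (β - 1) - -α / (β - 1) with hC
  have hC0 : 0 ≤ C := by
    have := hp.1.trans hp.2
    linarith
  have hstep : ∀ j : ℕ, 0 < j → ∀ K : ℕ, ∀ t d : ℝ, t ≤ C / β ^ K → t = β ^ j * d →
      d ≤ C / β ^ (K + 1) := by
    intro j hj K t d h1 h2
    rw [le_div_iff₀ (by positivity)] at h1 ⊢
    obtain ⟨i, rfl⟩ := Nat.exists_eq_add_of_lt hj
    by_cases hd : d ≤ 0
    · exact (mul_nonpos_of_nonpos_of_nonneg hd (by positivity)).trans hC0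
    · have h3 : (1 : ℝ) ≤ β ^ (0 + i) := one_le_pow₀ hβ.le
      have h4 : 0 ≤ d * β ^ (K + 1) := by
        have := not_le.1 hd
        positivity
      calc d * β ^ (K + 1) ≤ β ^ (0 + i) * (d * β ^ (K + 1)) := le_mul_of_one_le_left h4 h3
        _ = t * β ^ K := by rw [h2]; ring
        _ ≤ C := h1
  -- The claim holds up to an error `C / β ^ K`, with `C` the length of the domain. At the first
  -- difference `j` from the bound, the sequence is on its side up to this error by induction and
  -- the critical orbit is on the opposite one. Pulling back by `β ^ j` gains a factor `β`, since
  -- `j` is positive.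
  have key : ∀ K : ℕ, ∀ n, (ω n = 0 → expansionPoint β α (shift n ω) - critPt β α ≤ C / β ^ K) ∧
      (ω n = 1 → critPt β α - expansionPoint β α (shift n ω) ≤ C / β ^ K) := by
    intro K
    induction K with
    | zero =>
      intro n
      obtain ⟨h1, h2⟩ := expansionPoint_mem (α := α) hβ (shift n ω)
      obtain ⟨h3, h4⟩ := hp
      rw [pow_zero, div_one]
      exact ⟨fun _ => by linarith, fun _ => by linarith⟩
    | succ K ih =>
      intro n
      have hCK : 0 ≤ C / β ^ (K + 1) := by positivity
      constructor
      · intro h0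
        have ha := expansionPoint_shift_lowerExpansion hβ hα0 hα1 hp
        have ha0 := ha 0
        rw [shift_zero, Function.iterate_zero, id] at ha0
        by_cases heq : shift n ω = lowerExpansion β α (critPt β α)
        · rw [heq, ha0, sub_self]
          exact hCK
        · obtain ⟨j, hj, hj0, hj1⟩ := ((hω n).1 h0).exists_lt_of_ne heq
          have hjpos : 0 < j := by
            rcases Nat.eq_zero_or_pos j with rfl | h
            · rw [lowerExpansion_eq_one_iff] at hj1
              exact absurd hj1 (lt_irrefl _)
            · exact h
          have e := expansionPoint_sub_of_agree (α := α) hβ hj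
          rw [ha, ha0, shift_shift] at e
          refine hstep j hjpos K _ _ ?_ e
          have h1 := (ih (n + j)).1 hj0
          have h2 := lowerExpansion_eq_one_iff.1 hj1
          linarith
      · intro h0
        have ha := expansionPoint_shift_upperExpansion hβ hα0 hα1 hp
        have ha0 := ha 0
        rw [shift_zero, Function.iterate_zero, id] at ha0
        by_cases heq : upperExpansion β α (critPt β α) = shift n ω
        · rw [← heq, ha0, sub_self]
          exact hCK
        · obtain ⟨j, hj, hj0, hj1⟩ := ((hω n).2 h0).exists_lt_of_ne heq
          have hjpos : 0 < j := by
            rcases Nat.eq_zero_or_pos j with rfl | h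
            · rw [upperExpansion_eq_zero_iff] at hj0
              exact absurd hj0 (lt_irrefl _)
            · exact h
          have e := expansionPoint_sub_of_agree (α := α) hβ hj
          rw [ha, ha0, shift_shift] at e
          refine hstep j hjpos K _ _ ?_ e
          have h1 := (ih (n + j)).2 hj1
          have h2 := upperExpansion_eq_zero_iff.1 hj0
          linarith
  have hlim : Filter.Tendsto (fun K : ℕ => C / β ^ K) Filter.atTop (nhds 0) :=
    tendsto_const_nhds.div_atTop (tendsto_pow_atTop_atTop_of_one_lt hβ)
  exact ⟨fun h => sub_nonpos.1 (ge_of_tendsto' hlim fun K => (key K n).1 h),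
    fun h => sub_nonpos.1 (ge_of_tendsto' hlim fun K => (key K n).2 h)⟩

/-- At a first difference the two represented points would still coincide, yet one would be at most
the critical point and the other strictly above it. -/
theorem eq_lowerExpansion_of_expansionPoint_eq (hβ : 1 < β) (hα0 : 0 ≤ α) (hα1 : α ≤ 2 - β)
    {ω : ℕ → Fin 2}
    (hω : ω ∈ admissible (lowerExpansion β α (critPt β α)) (upperExpansion β α (critPt β α)))
    (h0 : ω 0 = 0) (he : expansionPoint β α ω = critPt β α) :
    ω = lowerExpansion β α (critPt β α) := by
  by_contra hne
  have ha := expansionPoint_shift_lowerExpansion hβ hα0 hα1 (critPt_mem hβ hα0 hα1)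
  have ha0 := ha 0
  rw [shift_zero, Function.iterate_zero, id] at ha0
  have hle := (hω 0).1 h0
  rw [shift_zero] at hle
  obtain ⟨j, hj, hj0, hj1⟩ := hle.exists_lt_of_ne hne
  have e := expansionPoint_sub_of_agree (α := α) hβ hj
  rw [ha, ha0, he, sub_self, mul_zero] at e
  have h1 := (expansionPoint_le_critPt hβ hα0 hα1 hω j).1 hj0
  have h2 := lowerExpansion_eq_one_iff.1 hj1
  linarith

theorem eq_upperExpansion_of_expansionPoint_eq (hβ : 1 < β) (hα0 : 0 ≤ α) (hα1 : α ≤ 2 - β)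
    {ω : ℕ → Fin 2}
    (hω : ω ∈ admissible (lowerExpansion β α (critPt β α)) (upperExpansion β α (critPt β α)))
    (h0 : ω 0 = 1) (he : expansionPoint β α ω = critPt β α) :
    ω = upperExpansion β α (critPt β α) := by
  by_contra hne
  have ha := expansionPoint_shift_upperExpansion hβ hα0 hα1 (critPt_mem hβ hα0 hα1)
  have ha0 := ha 0
  rw [shift_zero, Function.iterate_zero, id] at ha0
  have hle := (hω 0).2 h0
  rw [shift_zero] at hle
  obtain ⟨j, hj, hj0, hj1⟩ := hle.exists_lt_of_ne (Ne.symm hne)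
  have e := expansionPoint_sub_of_agree (α := α) hβ hj
  rw [ha, ha0, he, sub_self, mul_zero] at e
  have h1 := (expansionPoint_le_critPt hβ hα0 hα1 hω j).2 hj1
  have h2 := upperExpansion_eq_zero_iff.1 hj0
  linarith

/-- The intermediate `β`-shift consists of the sequences that are admissible for the two
expansions of the critical point. -/
theorem betaShift_eq_admissible (hβ : 1 < β) (hα0 : 0 ≤ α) (hα1 : α ≤ 2 - β) :
    betaShift β α =
      admissible (lowerExpansion β α (critPt β α)) (upperExpansion β α (critPt β α)) := by
  refine (betaShift_subset_admissible hβ).antisymm fun ω hω => ?_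
  have hp := critPt_mem hβ hα0 hα1
  have hside := expansionPoint_le_critPt hβ hα0 hα1 hω
  have hcases : ∀ n, ω n = 0 ∨ ω n = 1 := fun n => by omega
  -- The lower coding can fail only where the orbit sits at the critical point with letter `1`, the
  -- upper coding only where it sits there with letter `0`.
  have hlow : (∀ n, ω n = 1 → expansionPoint β α (shift n ω) ≠ critPt β α) →
      ω = lowerExpansion β α (expansionPoint β α ω) := by
    intro h
    have hiff : ∀ n, ω n = 0 ↔ expansionPoint β α (shift n ω) ≤ critPt β α := by
      intro n
      refine ⟨(hside n).1, fun hn => (hcases n).resolve_right fun h1 => ?_⟩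
      exact h n h1 (hn.antisymm ((hside n).2 h1))
    have horb : ∀ n, (lowerMap β α)^[n] (expansionPoint β α ω) =
        expansionPoint β α (shift n ω) := by
      intro n
      induction n with
      | zero => simp
      | succ n ih =>
        rw [lowerMap_iterate_succ, ih, expansionPoint_shift_succ hβ]
        have : lowerExpansion β α (expansionPoint β α ω) n = ω n := by
          have h1 := hiff n
          rw [← ih, ← lowerExpansion_eq_zero_iff] at h1
          have h2 := hcases n
          omega
        rw [this]
    ext n : 1
    have h1 := hiff n
    rw [← horb, ← lowerExpansion_eq_zero_iff] at h1
    have h2 := hcases n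
    omega
  have hupp : (∀ n, ω n = 0 → expansionPoint β α (shift n ω) ≠ critPt β α) →
      ω = upperExpansion β α (expansionPoint β α ω) := by
    intro h
    have hiff : ∀ n, ω n = 0 ↔ expansionPoint β α (shift n ω) < critPt β α := by
      intro n
      refine ⟨fun hn => lt_of_le_of_ne ((hside n).1 hn) (h n hn),
        fun hn => (hcases n).resolve_right fun h1 => ?_⟩
      exact absurd ((hside n).2 h1) (not_le.2 hn)
    have horb : ∀ n, (upperMap β α)^[n] (expansionPoint β α ω) =
        expansionPoint β α (shift n ω) := by
      intro n
      induction n with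
      | zero => simp
      | succ n ih =>
        rw [upperMap_iterate_succ, ih, expansionPoint_shift_succ hβ]
        have : upperExpansion β α (expansionPoint β α ω) n = ω n := by
          have h1 := hiff n
          rw [← ih, ← upperExpansion_eq_zero_iff] at h1
          have h2 := hcases n
          omega
        rw [this]
    ext n : 1
    have h1 := hiff n
    rw [← horb, ← upperExpansion_eq_zero_iff] at h1
    have h2 := hcases n
    omega
  by_cases h1 : ∀ n, ω n = 1 → expansionPoint β α (shift n ω) ≠ critPt β α
  · exact Or.inr ⟨_, expansionPoint_mem hβ ω, (hlow h1).symm⟩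
  by_cases h0 : ∀ n, ω n = 0 → expansionPoint β α (shift n ω) ≠ critPt β α
  · exact Or.inl ⟨_, expansionPoint_mem hβ ω, (hupp h0).symm⟩
  -- Both failures cannot occur: from the earlier one on, `ω` is an expansion of the critical point
  -- by one of the maps, and that map never assigns the other letter to this point.
  exfalso
  push Not at h0 h1
  obtain ⟨i, hi, hip⟩ := h1
  obtain ⟨j, hj, hjp⟩ := h0
  have ei := eq_upperExpansion_of_expansionPoint_eq hβ hα0 hα1 (shift_mem_admissible hω i)
    (by simpa using hi) hip
  have ej := eq_lowerExpansion_of_expansionPoint_eq hβ hα0 hα1 (shift_mem_admissible hω j)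
    (by simpa using hj) hjp
  rcases lt_trichotomy i j with hij | rfl | hij
  · obtain ⟨d, rfl⟩ := Nat.exists_eq_add_of_lt hij
    have h := expansionPoint_shift_upperExpansion hβ hα0 hα1 hp (d + 1)
    rw [← ei, shift_shift, ← add_assoc, hjp] at h
    have h2 := congrFun ei (d + 1)
    rw [shift_apply, ← add_assoc, hj] at h2
    exact absurd (upperExpansion_eq_zero_iff.1 h2.symm) (by rw [← h]; exact lt_irrefl _)
  · rw [hi] at hj
    exact absurd hj (by decide)
  · obtain ⟨d, rfl⟩ := Nat.exists_eq_add_of_lt hij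
    have h := expansionPoint_shift_lowerExpansion hβ hα0 hα1 hp (d + 1)
    rw [← ej, shift_shift, ← add_assoc, hip] at h
    have h2 := congrFun ej (d + 1)
    rw [shift_apply, ← add_assoc, hi] at h2
    exact absurd (lowerExpansion_eq_one_iff.1 h2.symm) (by rw [← h]; exact lt_irrefl _)

/-- The intermediate `β`-shift is of finite type if the critical point is periodic for both maps. -/
theorem isSubshiftOfFiniteType_betaShift (hβ : 1 < β) (hα0 : 0 ≤ α) (hα1 : α ≤ 2 - β)
    {P P' : ℕ} (hP : 0 < P) (hP' : 0 < P') (hl : (lowerMap β α)^[P] (critPt β α) = critPt β α)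
    (hu : (upperMap β α)^[P'] (critPt β α) = critPt β α) :
    IsSubshiftOfFiniteType (betaShift β α) := by
  rw [betaShift_eq_admissible hβ hα0 hα1]
  refine isSubshiftOfFiniteType_admissible hP hP' ?_ ?_
  · rw [shift_lowerExpansion, hl]
  · rw [shift_upperExpansion, hu]

/-- The intermediate `β`-shift is sofic if the critical point has finite orbits for both maps. -/
theorem isSofic_betaShift (hβ : 1 < β) (hα0 : 0 ≤ α) (hα1 : α ≤ 2 - β)
    (hl : (range fun i => (lowerMap β α)^[i] (critPt β α)).Finite)
    (hu : (range fun i => (upperMap β α)^[i] (critPt β α)).Finite) :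
    IsSofic (betaShift β α) := by
  rw [betaShift_eq_admissible hβ hα0 hα1]
  refine isSofic_admissible ?_ ?_
  · simp_rw [shift_lowerExpansion]
    rw [range_comp' (lowerExpansion β α)]
    exact hl.image _
  · simp_rw [shift_upperExpansion]
    rw [range_comp' (upperExpansion β α)]
    exact hu.image _

end Expansion

/-! ### The maps on the unit interval and multinacci numbers -/

section Unit

variable {b a : ℝ}

theorem mul_critPt (hb : 1 < b) : b * critPt b a = 1 - a := by
  unfold critPt
  field_simp

theorem upperMap_critPt (hb : 1 < b) : upperMap b a (critPt b a) = 0 := by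
  rw [upperMap, if_neg (lt_irrefl _), mul_critPt hb]
  ring

theorem lowerMap_critPt (hb : 1 < b) : lowerMap b a (critPt b a) = 1 := by
  rw [lowerMap, if_pos le_rfl, mul_critPt hb]
  ring

theorem lt_critPt_iff (hb : 1 < b) {x : ℝ} : x < critPt b a ↔ b * x + a < 1 := by
  rw [critPt, lt_div_iff₀ (by linarith)]
  constructor <;> intro h <;> linarith

theorem critPt_lt_iff (hb : 1 < b) {x : ℝ} : critPt b a < x ↔ 1 < b * x + a := by
  rw [critPt, div_lt_iff₀ (by linarith)]
  constructor <;> intro h <;> linarith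

theorem upperMap_mem_unit (hb : 1 < b) (ha : a ∈ Icc 0 (2 - b)) {x : ℝ} (hx : x ∈ Icc (0 : ℝ) 1) :
    upperMap b a x ∈ Icc (0 : ℝ) 1 := by
  obtain ⟨h1, h2⟩ := hx
  obtain ⟨h3, h4⟩ := ha
  have h5 : 0 ≤ b * x := by positivity
  have h6 : b * x ≤ b := by nlinarith
  unfold upperMap
  split_ifs with h <;> rw [lt_critPt_iff hb] at h
  · exact ⟨by linarith, by linarith⟩
  · exact ⟨by linarith, by linarith⟩

theorem lowerMap_mem_unit (hb : 1 < b) (ha : a ∈ Icc 0 (2 - b)) {x : ℝ} (hx : x ∈ Icc (0 : ℝ) 1) :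
    lowerMap b a x ∈ Icc (0 : ℝ) 1 := by
  obtain ⟨h1, h2⟩ := hx
  obtain ⟨h3, h4⟩ := ha
  have h5 : 0 ≤ b * x := by positivity
  have h6 : b * x ≤ b := by nlinarith
  unfold lowerMap
  split_ifs with h <;> rw [← not_lt, critPt_lt_iff hb] at h
  · exact ⟨by linarith, by linarith⟩
  · rw [not_not] at h
    exact ⟨by linarith, by linarith⟩

theorem upperMap_iterate_mem_unit (hb : 1 < b) (ha : a ∈ Icc 0 (2 - b)) {x : ℝ}
    (hx : x ∈ Icc (0 : ℝ) 1) (j : ℕ) : (upperMap b a)^[j] x ∈ Icc (0 : ℝ) 1 := by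
  induction j with
  | zero => exact hx
  | succ j ih =>
    rw [Function.iterate_succ_apply']
    exact upperMap_mem_unit hb ha ih

theorem lowerMap_iterate_mem_unit (hb : 1 < b) (ha : a ∈ Icc 0 (2 - b)) {x : ℝ}
    (hx : x ∈ Icc (0 : ℝ) 1) (j : ℕ) : (lowerMap b a)^[j] x ∈ Icc (0 : ℝ) 1 := by
  induction j with
  | zero => exact hx
  | succ j ih =>
    rw [Function.iterate_succ_apply']
    exact lowerMap_mem_unit hb ha ih

theorem critPt_mem_unit (hb : 1 < b) (ha : a ∈ Icc 0 (2 - b)) : critPt b a ∈ Icc (0 : ℝ) 1 := by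
  obtain ⟨h3, h4⟩ := ha
  exact ⟨not_lt.1 fun h => by rw [critPt_lt_iff hb] at h; linarith,
    not_lt.1 fun h => by rw [lt_critPt_iff hb] at h; linarith⟩

theorem lowerMap_iterate_eq_upperMap_iterate {x : ℝ} {j : ℕ}
    (h : ∀ i < j, (upperMap b a)^[i] x ≠ critPt b a) :
    (lowerMap b a)^[j] x = (upperMap b a)^[j] x := by
  induction j with
  | zero => rfl
  | succ j ih =>
    rw [Function.iterate_succ_apply', Function.iterate_succ_apply',
      ih fun i hi => h i (by omega), upperMap, lowerMap]
    simp [(h j (by omega)).le_iff_lt]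

/-! ### Multinacci bases: merging critical orbits and density of periodic parameters -/

/-- The parameters for which the critical point is periodic for both maps. -/
def PeriodicCrit (b a : ℝ) : Prop :=
  (∃ P, 0 < P ∧ (lowerMap b a)^[P] (critPt b a) = critPt b a) ∧
    ∃ P, 0 < P ∧ (upperMap b a)^[P] (critPt b a) = critPt b a

theorem IsMultinacci.mul_pow_eq_one {m : ℕ} (h : IsMultinacci m b) : (2 - b) * b ^ m = 1 := by
  have h1 := mul_neg_geom_sum b m
  rw [← h.2.2] at h1
  linarith

/-- The critical point goes to `0`, which then follows the left branch through the points a (b ^ i -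
1) / (b - 1). For i ≤ m these are at most a b ^ m < (2 - b) b ^ m = 1, which keeps the orbit left of
the critical point until the last step. -/
theorem IsMultinacci.upperMap_iterate_critPt {m : ℕ} (h : IsMultinacci m b)
    (ha : a ∈ Ioo 0 (2 - b)) : (upperMap b a)^[m + 1] (critPt b a) = a * b ^ m := by
  have hb := h.1
  have hm := h.mul_pow_eq_one
  obtain ⟨ha0, ha1⟩ := ha
  have key : ∀ i ≤ m, (b - 1) * (upperMap b a)^[i + 1] (critPt b a) = a * (b ^ i - 1) := by
    intro i
    induction i with
    | zero => simp [upperMap_critPt hb]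
    | succ i ih =>
      intro hi
      have ih' := ih (by omega)
      have hpow : b ^ (i + 1) ≤ b ^ m := pow_le_pow_right₀ hb.le hi
      have hlt : (upperMap b a)^[i + 1] (critPt b a) < critPt b a := by
        rw [lt_critPt_iff hb]
        have h1 : (b - 1) * (b * (upperMap b a)^[i + 1] (critPt b a) + a) =
            a * (b ^ (i + 1) - 1) := by
          rw [pow_succ']
          linear_combination b * ih'
        have h2 : a * (b ^ (i + 1) - 1) ≤ a * (b ^ m - 1) :=
          mul_le_mul_of_nonneg_left (by linarith) ha0.le
        have h3 : a * (b ^ m - 1) = (b - 1) * (a * b ^ m) := by linear_combination a * hm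
        have h4 : a * b ^ m < 1 := by
          rw [← hm]
          exact mul_lt_mul_of_pos_right ha1 (by positivity)
        nlinarith
      rw [Function.iterate_succ_apply', upperMap, if_pos hlt, pow_succ']
      linear_combination b * ih'
  have h1 := key m le_rfl
  have h3 : a * (b ^ m - 1) = (b - 1) * (a * b ^ m) := by linear_combination a * hm
  rw [h3] at h1
  exact mul_left_cancel₀ (by linarith) h1

/-- Mirror image under x ↦ 1 - x, a ↦ 2 - b - a: the orbit starts at `1`, follows the right branch,
and ends at distance (2 - b - a) b ^ m = 1 - a b ^ m from `1`, where the upper orbit arrives too. -/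
theorem IsMultinacci.lowerMap_iterate_critPt {m : ℕ} (h : IsMultinacci m b)
    (ha : a ∈ Ioo 0 (2 - b)) : (lowerMap b a)^[m + 1] (critPt b a) = a * b ^ m := by
  have hb := h.1
  have hm := h.mul_pow_eq_one
  obtain ⟨ha0, ha1⟩ := ha
  have key : ∀ i ≤ m, (b - 1) * (1 - (lowerMap b a)^[i + 1] (critPt b a)) =
      (2 - b - a) * (b ^ i - 1) := by
    intro i
    induction i with
    | zero => simp [lowerMap_critPt hb]
    | succ i ih =>
      intro hi
      have ih' := ih (by omega)
      have hpow : b ^ (i + 1) ≤ b ^ m := pow_le_pow_right₀ hb.le hi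
      have hlt : critPt b a < (lowerMap b a)^[i + 1] (critPt b a) := by
        rw [critPt_lt_iff hb]
        have h1 : (b - 1) * (2 - (b * (lowerMap b a)^[i + 1] (critPt b a) + a)) =
            (2 - b - a) * (b ^ (i + 1) - 1) := by
          rw [pow_succ']
          linear_combination b * ih'
        have h2 : (2 - b - a) * (b ^ (i + 1) - 1) ≤ (2 - b - a) * (b ^ m - 1) :=
          mul_le_mul_of_nonneg_left (by linarith) (by linarith)
        have h3 : (2 - b - a) * (b ^ m - 1) = (b - 1) * ((2 - b - a) * b ^ m) := by
          linear_combination (2 - b - a) * hm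
        have h4 : (2 - b - a) * b ^ m < 1 := by
          rw [← hm]
          exact mul_lt_mul_of_pos_right (by linarith) (by positivity)
        nlinarith
      rw [Function.iterate_succ_apply', lowerMap, if_neg (not_le.2 hlt), pow_succ']
      linear_combination b * ih'
  have h1 := key m le_rfl
  have h3 : (2 - b - a) * (b ^ m - 1) = (b - 1) * ((2 - b - a) * b ^ m) := by
    linear_combination (2 - b - a) * hm
  rw [h3] at h1
  have h4 := mul_left_cancel₀ (by linarith) h1
  linear_combination -h4 - hm

theorem IsMultinacci.periodicCrit {m j : ℕ} (h : IsMultinacci m b) (ha : a ∈ Ioo 0 (2 - b))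
    (hj : (upperMap b a)^[j] (a * b ^ m) = critPt b a) : PeriodicCrit b a := by
  classical
  have hex : ∃ j, (upperMap b a)^[j] (a * b ^ m) = critPt b a := ⟨j, hj⟩
  -- The two maps differ only at the critical point, so the merged orbit is common to both up to its
  -- first visit there; hence the least such time.
  have hmin := lowerMap_iterate_eq_upperMap_iterate fun i hi => Nat.find_min hex (m := i) hi
  have hspec := Nat.find_spec hex
  refine ⟨⟨Nat.find hex + (m + 1), by omega, ?_⟩, ⟨Nat.find hex + (m + 1), by omega, ?_⟩⟩
  · rw [Function.iterate_add_apply, h.lowerMap_iterate_critPt ha, hmin, hspec]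
  · rw [Function.iterate_add_apply, h.upperMap_iterate_critPt ha, hspec]

/-- If the orbit of `a * b ^ m` never meets the critical point on an interval of parameters, its
points depend affinely on the parameter, with exponentially growing slopes. -/
theorem upperMap_iterate_affine (hb : 1 < b) (m : ℕ) {c d : ℝ}
    (hne : ∀ a ∈ Ioo c d, ∀ j, (upperMap b a)^[j] (a * b ^ m) ≠ critPt b a) (j : ℕ) :
    ∃ A B : ℝ, b ^ j ≤ A ∧ ∀ a ∈ Ioo c d, (upperMap b a)^[j] (a * b ^ m) = A * a + B := by
  induction j with
  | zero => exact ⟨b ^ m, 0, by simpa using one_le_pow₀ hb.le, fun a _ => by simp [mul_comm]⟩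
  | succ j ih =>
    obtain ⟨A, B, hA, hAB⟩ := ih
    have hA' : b ^ (j + 1) ≤ b * A + 1 := by
      rw [pow_succ']
      nlinarith
    -- One branch serves the whole parameter interval: a change of side would produce, by the
    -- intermediate value theorem, a parameter whose orbit hits the critical point.
    by_cases hlt : ∀ a ∈ Ioo c d, A * a + B < critPt b a
    · refine ⟨b * A + 1, b * B, hA', fun a ha => ?_⟩
      rw [Function.iterate_succ_apply', hAB a ha, upperMap, if_pos (hlt a ha)]
      ring
    · refine ⟨b * A + 1, b * B - 1, hA', fun a ha => ?_⟩
      push Not at hlt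
      obtain ⟨a', ha', hle'⟩ := hlt
      rw [Function.iterate_succ_apply', hAB a ha, upperMap, if_neg]
      · ring
      · intro hle
        obtain ⟨x, hx, he⟩ := isPreconnected_Ioo.intermediate_value₂ ha ha'
          (f := fun a => A * a + B) (g := critPt b) (by fun_prop)
          (by unfold critPt; fun_prop) hle.le hle'
        exact hne x hx j ((hAB x hx).trans he)

theorem IsMultinacci.exists_periodicCrit {m : ℕ} (h : IsMultinacci m b) {c d : ℝ} (hc : 0 ≤ c)
    (hcd : c < d) (hd : d ≤ 2 - b) : ∃ a ∈ Ioo c d, PeriodicCrit b a := by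
  have hb := h.1
  have hsub : ∀ a ∈ Ioo c d, a ∈ Ioo 0 (2 - b) := fun a ha =>
    ⟨hc.trans_lt ha.1, ha.2.trans_le hd⟩
  by_contra! hno
  have hne : ∀ a ∈ Ioo c d, ∀ j, (upperMap b a)^[j] (a * b ^ m) ≠ critPt b a :=
    fun a ha j hj => hno a ha (h.periodicCrit (hsub a ha) hj)
  obtain ⟨a₁, ha₁⟩ := exists_between hcd
  obtain ⟨a₂, ha₂⟩ := exists_between ha₁.2
  have hlt : 0 < a₂ - a₁ := sub_pos.2 ha₂.1
  obtain ⟨j, hj⟩ := pow_unbounded_of_one_lt (1 / (a₂ - a₁)) hb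
  obtain ⟨A, B, hA, hAB⟩ := upperMap_iterate_affine hb m hne j
  have hmem : ∀ a ∈ Ioo c d, A * a + B ∈ Icc (0 : ℝ) 1 := by
    intro a ha
    have ha' := hsub a ha
    rw [← hAB a ha]
    refine upperMap_iterate_mem_unit hb (Ioo_subset_Icc_self ha') ⟨?_, ?_⟩ j
    · have := ha'.1
      positivity
    · rw [← h.mul_pow_eq_one]
      exact mul_le_mul_of_nonneg_right ha'.2.le (by positivity)
  have h1 := (hmem a₁ ha₁).1
  have h2 := (hmem a₂ ⟨ha₁.1.trans ha₂.1, ha₂.2⟩).2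
  rw [div_lt_iff₀ hlt] at hj
  nlinarith

theorem IsMultinacci.dense_periodicCrit {m : ℕ} (h : IsMultinacci m b) :
    Icc 0 (2 - b) ⊆ closure {a | a ∈ Icc 0 (2 - b) ∧ PeriodicCrit b a} := by
  have h2 : (0 : ℝ) < 2 - b := by linarith [h.2.1]
  refine (closure_Ioo h2.ne).symm.subset.trans (closure_minimal (fun x hx => ?_) isClosed_closure)
  rw [mem_closure_iff_nhds_basis (nhds_basis_Ioo x)]
  rintro ⟨c, d⟩ ⟨hc, hd⟩
  obtain ⟨a, ha, hP⟩ := h.exists_periodicCrit (c := max 0 c) (d := min d (2 - b))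
    (le_max_left _ _) ((max_lt hx.1 hc).trans (lt_min hd hx.2)) (min_le_right _ _)
  have ha1 := max_lt_iff.1 ha.1
  have ha2 := lt_min_iff.1 ha.2
  exact ⟨a, ⟨⟨ha1.1.le, ha2.2.le⟩, hP⟩, ha1.2, ha2.1⟩

end Unit

/-! ### Pisot numbers -/

section Pisot

variable {b a : ℝ}

open IntermediateField in
/-- A bounded orbit of `x ↦ b x + e` with a Pisot number `b` and bounded integers `e` is finite. -/
theorem IsPisot.finite_range (hb : IsPisot b) {y : ℕ → ℝ} {e : ℕ → ℤ} {c : ℤ} {B E : ℝ}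
    (h0 : y 0 = c) (hy : ∀ n, y (n + 1) = b * y n + e n) (hB : ∀ n, |y n| ≤ B)
    (hE : ∀ n, |(e n : ℝ)| ≤ E) : (range y).Finite := by
  obtain ⟨hint, -, hconj⟩ := hb
  have hintQ : IsIntegral ℚ b := hint.tower_top
  have hfd : FiniteDimensional ℚ ℚ⟮b⟯ := adjoin.finiteDimensional hintQ
  have hnf : NumberField ℚ⟮b⟯ := { }
  set g : ℚ⟮b⟯ := AdjoinSimple.gen ℚ b with hg
  have hgb : algebraMap ℚ⟮b⟯ ℝ g = b := AdjoinSimple.algebraMap_gen ℚ b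
  have hgint : IsIntegral ℤ g := by
    rw [← isIntegral_algebraMap_iff (algebraMap ℚ⟮b⟯ ℝ).injective, hgb]
    exact hint
  let Y : ℕ → ℚ⟮b⟯ := fun n => Nat.rec (c : ℚ⟮b⟯) (fun n t => g * t + (e n : ℚ⟮b⟯)) n
  have hY0 : Y 0 = (c : ℚ⟮b⟯) := rfl
  have hYs : ∀ n, Y (n + 1) = g * Y n + (e n : ℚ⟮b⟯) := fun n => rfl
  have hYy : ∀ n, algebraMap ℚ⟮b⟯ ℝ (Y n) = y n := by
    intro n
    induction n with
    | zero => rw [hY0, h0, map_intCast]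
    | succ n ih => rw [hYs, hy, map_add, map_mul, ih, hgb, map_intCast]
  have hYint : ∀ n, IsIntegral ℤ (Y n) := by
    intro n
    induction n with
    | zero => exact hY0 ▸ isIntegral_algebraMap (R := ℤ) (x := c)
    | succ n ih =>
      rw [hYs]
      exact (hgint.mul ih).add (isIntegral_algebraMap (R := ℤ) (x := e n))
  have hE0 : 0 ≤ E := (abs_nonneg _).trans (hE 0)
  -- Embeddings fixing `b` are controlled by the bounded orbit; in the others multiplication by `φ
  -- g` is a contraction, and a geometric series gives the bound.
  have hbound : ∀ φ : ℚ⟮b⟯ →+* ℂ, ∃ M : ℝ, ∀ n, ‖φ (Y n)‖ ≤ M := by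
    intro φ
    by_cases hφ : φ g = (b : ℂ)
    · refine ⟨B, fun n => ?_⟩
      have : φ (Y n) = (y n : ℂ) := by
        induction n with
        | zero => rw [hY0, h0, map_intCast, Complex.ofReal_intCast]
        | succ n ih => rw [hYs, hy, map_add, map_mul, ih, hφ, map_intCast]; push_cast; rfl
      rw [this, Complex.norm_real, Real.norm_eq_abs]
      exact hB n
    · have hroot : Polynomial.aeval (φ g) (minpoly ℚ b) = 0 := by
        have h1 : Polynomial.aeval g (minpoly ℚ b) = 0 := by
          apply (algebraMap ℚ⟮b⟯ ℝ).injective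
          rw [← Polynomial.aeval_algebraMap_apply, hgb, minpoly.aeval, map_zero]
        have h2 := Polynomial.hom_eval₂ (minpoly ℚ b) (algebraMap ℚ ℚ⟮b⟯) φ g
        rw [← Polynomial.aeval_def, h1, map_zero,
          Subsingleton.elim (φ.comp (algebraMap ℚ ℚ⟮b⟯)) (algebraMap ℚ ℂ)] at h2
        exact h2.symm
      have hr := hconj (φ g) hroot hφ
      have hr' : 0 < 1 - ‖φ g‖ := by linarith
      refine ⟨|(c : ℝ)| + E / (1 - ‖φ g‖), fun n => ?_⟩
      induction n with
      | zero =>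
        rw [hY0, map_intCast, Complex.norm_intCast]
        have : 0 ≤ E / (1 - ‖φ g‖) := by positivity
        linarith
      | succ n ih =>
        rw [hYs, map_add, map_mul, map_intCast]
        have hM : E ≤ (|(c : ℝ)| + E / (1 - ‖φ g‖)) * (1 - ‖φ g‖) := by
          rw [add_mul, div_mul_cancel₀ _ hr'.ne']
          have : 0 ≤ |(c : ℝ)| * (1 - ‖φ g‖) := by positivity
          linarith
        calc ‖φ g * φ (Y n) + (e n : ℂ)‖ ≤ ‖φ g‖ * ‖φ (Y n)‖ + ‖(e n : ℂ)‖ := by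
              rw [← norm_mul]
              exact norm_add_le _ _
          _ ≤ ‖φ g‖ * (|(c : ℝ)| + E / (1 - ‖φ g‖)) + E := by
              rw [Complex.norm_intCast]
              exact add_le_add (mul_le_mul_of_nonneg_left ih (norm_nonneg _)) (hE n)
          _ ≤ _ := by linarith
  choose M hM using hbound
  obtain ⟨C, hC⟩ := (Set.finite_range M).bddAbove
  refine ((NumberField.Embeddings.finite_of_norm_le ℚ⟮b⟯ ℂ C).image
    (algebraMap ℚ⟮b⟯ ℝ)).subset ?_
  rintro _ ⟨n, rfl⟩
  exact ⟨Y n, ⟨hYint n, fun φ => (hM φ n).trans (hC ⟨φ, rfl⟩)⟩, hYy n⟩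

/-- A bounded orbit of `x ↦ b x + a - ω` with a Pisot number `b`, rational `a` and binary digits
that starts at an integer is finite. -/
theorem IsPisot.finite_range_of_digits (hb : IsPisot b) {q : ℚ} {x : ℕ → ℝ} {ω : ℕ → Fin 2}
    {c : ℤ} (h0 : x 0 = c) (hx : ∀ n, x (n + 1) = b * x n + q - (ω n : ℕ))
    (hmem : ∀ n, x n ∈ Icc (0 : ℝ) 1) : (range x).Finite := by
  have hq : (q.den : ℝ) ≠ 0 := by exact_mod_cast q.den_nz
  have hqq : (q.den : ℝ) * q = q.num := by
    have := Rat.den_mul_eq_num q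
    exact_mod_cast this
  -- Multiplying by the denominator of `q` makes the start and the added terms integers.
  have hfin := hb.finite_range (y := fun n => q.den * x n)
    (e := fun n => q.num - q.den * (ω n : ℕ)) (c := q.den * c) (B := q.den)
    (E := |(q.num : ℝ)| + q.den) (by simp [h0])
    (fun n => by
      rw [hx]
      push_cast
      linear_combination hqq)
    (fun n => by
      obtain ⟨h1, h2⟩ := hmem n
      rw [abs_of_nonneg (by positivity)]
      exact mul_le_of_le_one_right (by positivity) h2)
    (fun n => by
      obtain ⟨h1, h2⟩ := digit_mem_Icc (ω n)
      push_cast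
      refine (abs_sub _ _).trans (add_le_add le_rfl ?_)
      rw [abs_of_nonneg (by positivity)]
      exact mul_le_of_le_one_right (by positivity) h2)
  refine Set.Finite.of_finite_image (f := fun t : ℝ => (q.den : ℝ) * t) ?_
    (mul_right_injective₀ hq).injOn
  rwa [← range_comp]

/-- The parameters for which the critical point has finite orbits for both maps. -/
def FiniteCrit (b a : ℝ) : Prop :=
  (range fun i => (lowerMap b a)^[i] (critPt b a)).Finite ∧
    (range fun i => (upperMap b a)^[i] (critPt b a)).Finite

theorem finite_range_of_succ {A : Type*} {x : ℕ → A} (h : (range fun i => x (i + 1)).Finite) :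
    (range x).Finite := by
  refine (h.insert (x 0)).subset ?_
  rintro _ ⟨_ | i, rfl⟩
  · exact mem_insert _ _
  · exact mem_insert_of_mem _ ⟨i, rfl⟩

theorem IsPisot.finiteCrit (hb : IsPisot b) {q : ℚ} (hq : (q : ℝ) ∈ Icc 0 (2 - b)) :
    FiniteCrit b q := by
  have hb1 := hb.2.1
  have hp := critPt_mem_unit hb1 hq
  constructor
  · apply finite_range_of_succ
    exact hb.finite_range_of_digits (c := 1) (by simp [lowerMap_critPt hb1])
      (fun n => lowerMap_iterate_succ _ _) fun n => lowerMap_iterate_mem_unit hb1 hq hp _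
  · apply finite_range_of_succ
    exact hb.finite_range_of_digits (c := 0) (by simp [upperMap_critPt hb1])
      (fun n => upperMap_iterate_succ _ _) fun n => upperMap_iterate_mem_unit hb1 hq hp _

theorem IsPisot.dense_finiteCrit (hb : IsPisot b) :
    Icc 0 (2 - b) ⊆ closure {a | a ∈ Icc 0 (2 - b) ∧ FiniteCrit b a} := by
  rcases lt_trichotomy b 2 with h2 | h2 | h2
  · have h2' : (0 : ℝ) < 2 - b := by linarith
    refine (closure_Ioo h2'.ne).symm.subset.trans
      (closure_minimal (fun x hx => ?_) isClosed_closure)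
    rw [mem_closure_iff_nhds_basis (nhds_basis_Ioo x)]
    rintro ⟨c, d⟩ ⟨hc, hd⟩
    obtain ⟨q, hq1, hq2⟩ := exists_rat_btwn ((max_lt hx.1 hc).trans (lt_min hd hx.2))
    have h1 := max_lt_iff.1 hq1
    have h2 := lt_min_iff.1 hq2
    have hmem : (q : ℝ) ∈ Icc 0 (2 - b) := ⟨h1.1.le, h2.2.le⟩
    exact ⟨q, ⟨hmem, hb.finiteCrit hmem⟩, h1.2, h2.1⟩
  -- Integers are Pisot numbers too; for `b = 2` the parameter interval is the single rational point
  -- `0`.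
  · intro x hx
    apply subset_closure
    have hx0 : x = ((0 : ℚ) : ℝ) := by
      have := hx.1
      have := hx.2
      push_cast
      linarith
    rw [hx0] at hx ⊢
    exact ⟨hx, hb.finiteCrit hx⟩
  · rw [Icc_eq_empty (by linarith)]
    exact empty_subset _

end Pisot

/-! ### Rotation words -/

/-- The `i`-th letter of the rotation word with slope `k / n`. -/
def rotDigit (n k i : ℕ) : ℕ := (i + 1) * k / n - i * k / n

theorem rotDigit_of_lt {n k i : ℕ} (h : i * k % n + k < n) : rotDigit n k i = 0 := by
  have hn : 0 < n := by omega
  have h1 : (i + 1) * k / n = i * k / n := by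
    have h2 := Nat.div_add_mod (i * k) n
    apply Nat.div_eq_of_lt_le
    · nlinarith [Nat.zero_le k, Nat.zero_le (i * k % n)]
    · nlinarith
  rw [rotDigit, h1, Nat.sub_self]

theorem rotDigit_of_le {n k i : ℕ} (hkn : k < n) (h : n ≤ i * k % n + k) : rotDigit n k i = 1 := by
  have hn : 0 < n := by omega
  have h1 : (i + 1) * k / n = i * k / n + 1 := by
    have h2 := Nat.div_add_mod (i * k) n
    have h3 := Nat.mod_lt (i * k) hn
    apply Nat.div_eq_of_lt_le
    · nlinarith [Nat.zero_le k, Nat.zero_le (i * k % n)]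
    · nlinarith
  rw [rotDigit, h1, Nat.add_sub_cancel_left]

/-- The left end points of the intervals visited by the renormalised map. -/
noncomputable def leftPt (n k : ℕ) (β α : ℝ) : ℕ → ℝ
  | 0 => 0
  | i + 1 => β * leftPt n k β α i + α - rotDigit n k i

/-- The right end points of the intervals visited by the renormalised map, with a shift of the
index by one. -/
noncomputable def rightPt (n k : ℕ) (β α : ℝ) (i : ℕ) : ℝ :=
  leftPt n k β α (i + 1) + (β - 1) * β ^ i

theorem rightPt_succ (n k : ℕ) (β α : ℝ) (i : ℕ) :
    rightPt n k β α (i + 1) = β * rightPt n k β α i + α - rotDigit n k (i + 1) := by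
  rw [rightPt, rightPt, leftPt]
  ring

/-- The affine function of `α` whose values in `[1, 1 + (β - 1) (2 - β ^ n)]` characterise the
renormalisable parameters. -/
noncomputable def renormLevel (n k : ℕ) (β α : ℝ) : ℝ := β * (β * leftPt n k β α (n - 1) + α)

/-- The parameter of the renormalised map. -/
noncomputable def renormParam (n k : ℕ) (β α : ℝ) : ℝ := (renormLevel n k β α - 1) / (β - 1)

/-- A sequence of gaps that are scaled by at least `β⁻¹` under a rotation is nonnegative. -/
theorem nonneg_of_rotation {n k : ℕ} {β : ℝ} (hβ : 1 < β) (hkn : k < n) {g : ℕ → ℝ}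
    (h1 : ∀ r, r + k < n → g (r + k) ≤ β * g r)
    (h2 : ∀ r, n ≤ r + k → r < n → g (r + k - n) ≤ β * g r) : ∀ r < n, 0 ≤ g r := by
  obtain ⟨r₀, hr₀, hmin⟩ := Finset.exists_min_image (Finset.range n) g
    (Finset.nonempty_range_iff.2 (by omega))
  rw [Finset.mem_range] at hr₀
  have key : g r₀ ≤ β * g r₀ := by
    by_cases h : r₀ + k < n
    · exact (hmin _ (Finset.mem_range.2 h)).trans (h1 r₀ h)
    · exact (hmin _ (Finset.mem_range.2 (by omega))).trans (h2 r₀ (by omega) hr₀)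
  have h0 : 0 ≤ g r₀ := by nlinarith
  exact fun r hr => h0.trans (hmin r (Finset.mem_range.2 hr))

theorem exists_residue_index {n k : ℕ} (hn : 2 ≤ n) (hgcd : Nat.gcd n k = 1) :
    ∃ ι : ℕ → ℕ, (∀ r < n, ι r < n ∧ ι r * k % n = r) ∧
      ∀ i < n, ι (i * k % n) = i := by
  have hcop : Nat.Coprime n k := hgcd
  obtain ⟨m, -, hm⟩ := Nat.exists_mul_mod_eq_one_of_coprime hcop.symm (by omega)
  have hι : ∀ r < n, r * m % n < n ∧ r * m % n * k % n = r := by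
    intro r hr
    refine ⟨Nat.mod_lt _ (by omega), ?_⟩
    rw [Nat.mod_mul_mod, mul_assoc, mul_comm m k, Nat.mul_mod, hm, mul_one, Nat.mod_mod,
      Nat.mod_eq_of_lt hr]
  refine ⟨fun r => r * m % n, hι, fun i hi => ?_⟩
  obtain ⟨h1, h2⟩ := hι (i * k % n) (Nat.mod_lt _ (by omega))
  have h3 : Nat.ModEq n (i * k % n * m % n) i :=
    Nat.ModEq.cancel_right_of_coprime hcop (h2.trans rfl)
  rw [Nat.ModEq, Nat.mod_eq_of_lt h1, Nat.mod_eq_of_lt hi] at h3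
  exact h3

/-! ### Linear order of the visited intervals -/

section Renormalization

variable {n k : ℕ} {β α : ℝ}

/-- The order of the intervals visited by the renormalised map: `u` and `v` are the end points of
the central interval. -/
structure RenormOrder (n k : ℕ) (β α u v : ℝ) : Prop where
  nonneg : 0 ≤ α
  le_two_sub : α ≤ 2 - β
  image_right_le : β * v + α - 1 ≤ u
  le_image_left : v ≤ β * u + α
  rightPt_le : ∀ i, i + 2 < n → rotDigit n k (i + 1) = 0 → rightPt n k β α i ≤ u
  le_leftPt : ∀ i, i + 2 < n → rotDigit n k (i + 1) = 1 → v ≤ leftPt n k β α (i + 1)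

theorem rightPt_sub_two (hn : 2 ≤ n) :
    rightPt n k β α (n - 2) = leftPt n k β α (n - 1) + (β - 1) * β ^ (n - 2) := by
  rw [rightPt, show n - 2 + 1 = n - 1 by omega]

theorem mul_rightPt_sub_two (hn : 2 ≤ n) :
    β * (β * rightPt n k β α (n - 2) + α - 1) =
      renormLevel n k β α + β ^ n * (β - 1) - β := by
  obtain ⟨m, rfl⟩ := Nat.exists_eq_add_of_le hn
  rw [rightPt_sub_two hn, renormLevel, Nat.add_sub_cancel_left]
  ring

/-- Label the i-th interval by the residue of `i * k` modulo `n`, so that the dynamics is r ↦ r + k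
on labels and the central interval has label `n - k`. Each gap between neighbouring labels is
followed by one at most `β` times as large, so the least gap is nonnegative and the labels give the
order on the line. The bounds on `renormLevel` say that the second images of both halves of the
central interval stay in [α, α + β - 1], the interval with label `k`. -/
theorem renormOrder (hn : 2 ≤ n) (hk : 0 < k) (hkn : k < n) (hgcd : Nat.gcd n k = 1) (hβ : 1 < β)
    (h1 : 1 ≤ renormLevel n k β α)
    (h2 : renormLevel n k β α ≤ 2 * β - 1 - β ^ n * (β - 1)) :
    RenormOrder n k β α (leftPt n k β α (n - 1)) (rightPt n k β α (n - 2)) := by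
  obtain ⟨ι, hι, hι'⟩ := exists_residue_index hn hgcd
  set u := leftPt n k β α (n - 1) with hu
  set v := rightPt n k β α (n - 2) with hv
  have hβ0 : 0 < β := by linarith
  have hβn : 1 ≤ β ^ n := one_le_pow₀ hβ.le
  have hv1 : β * (β * v + α - 1) = renormLevel n k β α + β ^ n * (β - 1) - β :=
    mul_rightPt_sub_two hn
  have hu1 : β * (β * u + α) = renormLevel n k β α := rfl
  have hTv0 : 0 ≤ β * v + α - 1 := by
    have : 0 ≤ β * (β * v + α - 1) := by nlinarith
    exact nonneg_of_mul_nonneg_right this hβ0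
  have hTu1 : β * u + α ≤ 1 := by
    have : β * (β * u + α) ≤ β * 1 := by nlinarith
    exact le_of_mul_le_mul_left this hβ0
  -- The extreme labels `0` and `n` stand for the images of the right and left halves of the central
  -- interval.
  let lo : ℕ → ℝ := fun r => if r = 0 then 0 else if r = n then β * u + α else leftPt n k β α (ι r)
  let hi : ℕ → ℝ := fun r =>
    if r = 0 then β * v + α - 1 else if r = n then 1 else rightPt n k β α (ι r - 1)
  have hιpos : ∀ r, r ≠ 0 → r < n → ι r ≠ 0 := by
    intro r h0 hr h
    have := (hι r hr).2
    rw [h, zero_mul, Nat.zero_mod] at this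
    exact h0 this.symm
  have hlo : ∀ i, 0 < i → i < n → lo (i * k % n) = leftPt n k β α i := by
    intro i hi0 hin
    have hr : i * k % n ≠ 0 := by
      intro h
      have h3 := hι' i hin
      have h4 := hι' 0 (by omega)
      rw [h] at h3
      rw [zero_mul, Nat.zero_mod] at h4
      omega
    simp only [lo, if_neg hr, if_neg (Nat.mod_lt (i * k) (show 0 < n by omega)).ne, hι' i hin]
  have hhi : ∀ i, i + 1 < n → hi ((i + 1) * k % n) = rightPt n k β α i := by
    intro i hin
    have hr : (i + 1) * k % n ≠ 0 := by
      intro h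
      have h3 := hι' (i + 1) hin
      have h4 := hι' 0 (by omega)
      rw [h] at h3
      rw [zero_mul, Nat.zero_mod] at h4
      omega
    simp only [hi, if_neg hr, if_neg (Nat.mod_lt ((i + 1) * k) (show 0 < n by omega)).ne,
      hι' (i + 1) hin, Nat.add_sub_cancel]
  have hcent : (n - 1) * k % n = n - k := by
    have : (n - 1) * k = n * (k - 1) + (n - k) := by
      obtain ⟨a, rfl⟩ := Nat.exists_eq_add_of_lt hkn
      obtain ⟨c, rfl⟩ := Nat.exists_eq_add_of_lt hk
      simp only [Nat.add_sub_cancel, Nat.zero_add]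
      rw [show c + 1 + a + 1 - (c + 1) = a + 1 by omega]
      ring
    rw [this, Nat.mul_add_mod, Nat.mod_eq_of_lt (by omega)]
  have hlo_cent : lo (n - k) = u := by rw [← hcent, hlo _ (by omega) (by omega)]
  have hhi_cent : hi (n - k) = v := by
    rw [← hcent, show n - 1 = n - 2 + 1 by omega, hhi _ (by omega)]
  have hlo0 : lo 0 = 0 := by simp [lo]
  have hhi0 : hi 0 = β * v + α - 1 := by simp [hi]
  have hlon : lo n = β * u + α := by simp [lo, show n ≠ 0 by omega]
  have hhin : hi n = 1 := by simp [hi, show n ≠ 0 by omega]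
  have hkmod : 1 * k % n = k := by rw [one_mul, Nat.mod_eq_of_lt hkn]
  have hlok : lo k = α := by
    rw [← hkmod, hlo 1 one_pos (by omega), leftPt, leftPt, rotDigit_of_lt (by simpa using hkn)]
    simp
  have hhik : hi k = α + β - 1 := by
    have := hhi 0 (by omega)
    rw [zero_add, hkmod] at this
    rw [this, rightPt, leftPt, leftPt, rotDigit_of_lt (by simpa using hkn)]
    simp only [mul_zero, zero_add, Nat.cast_zero, sub_zero, pow_zero, mul_one]
    ring
  have hres : ∀ r, r ≠ 0 → r < n → r ≠ n - k → ∃ i, r = (i + 1) * k % n ∧ i + 2 < n := by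
    intro r h0 hr hrk
    refine ⟨ι r - 1, ?_, ?_⟩
    · rw [Nat.sub_add_cancel (Nat.pos_of_ne_zero (hιpos r h0 hr)), (hι r hr).2]
    · have h3 : ι r ≠ n - 1 := by
        intro h
        have := (hι r hr).2
        rw [h, hcent] at this
        exact hrk this.symm
      have := (hι r hr).1
      have := hιpos r h0 hr
      omega
  have hmodadd : ∀ i, (i + 1) * k % n = (i * k % n + k) % n := by
    intro i
    rw [Nat.mod_add_mod, add_mul, one_mul]
  have hstep0 : ∀ r, r ≠ 0 → r + k < n → lo (r + k) = β * lo r + α ∧ hi (r + k) = β * hi r + α := by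
    intro r h0 hr
    obtain ⟨i, hi1, hi2⟩ := hres r h0 (by omega) (by omega)
    have hc : rotDigit n k (i + 1) = 0 := rotDigit_of_lt (by rw [← hi1]; exact hr)
    have hr' : r + k = (i + 1 + 1) * k % n := by
      rw [hmodadd, ← hi1, Nat.mod_eq_of_lt hr]
    rw [hr', hlo _ (by omega) (by omega), hhi _ (by omega), hi1, hlo _ (by omega) (by omega),
      hhi _ (by omega), rightPt_succ, leftPt, hc]
    simp
  have hstep1 : ∀ r, r < n → n < r + k →
      lo (r + k - n) = β * lo r + α - 1 ∧ hi (r + k - n) = β * hi r + α - 1 := by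
    intro r hrn hr
    obtain ⟨i, hi1, hi2⟩ := hres r (by omega) (by omega) (by omega)
    have hc : rotDigit n k (i + 1) = 1 := rotDigit_of_le hkn (by rw [← hi1]; exact hr.le)
    have hr' : r + k - n = (i + 1 + 1) * k % n := by
      rw [hmodadd, ← hi1, Nat.mod_eq_sub_mod hr.le, Nat.mod_eq_of_lt (by omega)]
    rw [hr', hlo _ (by omega) (by omega), hhi _ (by omega), hi1, hlo _ (by omega) (by omega),
      hhi _ (by omega), rightPt_succ, leftPt, hc]
    simp
  have hA : ∀ s, 0 < s → s + k ≤ n → lo (s + k) ≤ β * lo s + α := by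
    intro s hs hsk
    rcases hsk.lt_or_eq with h | h
    · exact (hstep0 s hs.ne' h).1.le
    · rw [h, hlon, show s = n - k by omega, hlo_cent]
  -- Equality can fail only at `r = 0`, where `h2` is needed; symmetrically, `hC` needs `h1` at `s =
  -- n`.
  have hB : ∀ r, r + k < n → β * hi r + α ≤ hi (r + k) := by
    intro r hr
    rcases Nat.eq_zero_or_pos r with rfl | h
    · rw [zero_add, hhi0, hhik]
      nlinarith
    · exact (hstep0 r h.ne' hr).2.ge
  have hC : ∀ s, s ≤ n → n < s + k → lo (s + k - n) ≤ β * lo s + α - 1 := by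
    intro s hs hsk
    rcases hs.lt_or_eq with h | h
    · exact (hstep1 s h hsk).1.le
    · rw [h, hlon, Nat.add_sub_cancel_left, hlok]
      nlinarith
  have hD : ∀ r, n ≤ r + k → r < n → β * hi r + α - 1 ≤ hi (r + k - n) := by
    intro r hr hrn
    rcases hr.lt_or_eq with h | h
    · exact (hstep1 r hrn h).2.ge
    · rw [← h, Nat.sub_self, hhi0, show r = n - k by omega, hhi_cent]
  have hgap : ∀ r < n, 0 ≤ lo (r + 1) - hi r := by
    refine nonneg_of_rotation hβ hkn (fun r hr => ?_) (fun r hr hrn => ?_)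
    · have e1 := hA (r + 1) (by omega) (by omega)
      have e2 := hB r hr
      rw [show r + 1 + k = r + k + 1 by omega] at e1
      linarith
    · have e1 := hC (r + 1) (by omega) (by omega)
      have e2 := hD r hr hrn
      rw [show r + 1 + k - n = r + k - n + 1 by omega] at e1
      linarith
  have hwidth : ∀ r ≤ n, lo r ≤ hi r := by
    intro r hr
    rcases Nat.eq_zero_or_pos r with rfl | h0
    · rwa [hlo0, hhi0]
    rcases hr.lt_or_eq with h | rfl
    · have h3 := hιpos r h0.ne' h
      simp only [lo, hi, if_neg h0.ne', if_neg h.ne, rightPt,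
        Nat.sub_add_cancel (Nat.pos_of_ne_zero h3)]
      have : 0 ≤ (β - 1) * β ^ (ι r - 1) := mul_nonneg (by linarith) (by positivity)
      linarith
    · rwa [hlon, hhin]
  have hsorted : ∀ d r, r + d + 1 ≤ n → hi r ≤ lo (r + d + 1) := by
    intro d
    induction d with
    | zero =>
      intro r hr
      have := hgap r (by omega)
      simpa using this
    | succ d ih =>
      intro r hr
      have e1 := ih r (by omega)
      have e2 := hwidth (r + d + 1) (by omega)
      have e3 := hgap (r + d + 1) (by omega)
      rw [show r + (d + 1) + 1 = r + d + 1 + 1 by omega]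
      linarith
  have hlt : ∀ r s, r < s → s ≤ n → hi r ≤ lo s := by
    intro r s hrs hs
    obtain ⟨d, rfl⟩ := Nat.exists_eq_add_of_lt hrs
    exact hsorted d r hs
  refine ⟨?_, ?_, ?_, ?_, ?_, ?_⟩
  · have e1 := hlt 0 k hk hkn.le
    rw [hhi0, hlok] at e1
    linarith
  · have e1 := hlt k n hkn le_rfl
    rw [hhik, hlon] at e1
    linarith
  · have e1 := hlt 0 (n - k) (by omega) (by omega)
    rwa [hhi0, hlo_cent] at e1
  · have e1 := hlt (n - k) n (by omega) le_rfl
    rwa [hhi_cent, hlon] at e1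
  · intro i hi2 hc
    rw [← hhi i (by omega), ← hlo_cent]
    apply hlt _ _ _ (by omega)
    by_contra hge
    rw [rotDigit_of_le hkn (by omega)] at hc
    omega
  · intro i hi2 hc
    rw [← hlo (i + 1) (by omega) (by omega), ← hhi_cent]
    have hne : (i + 1) * k % n ≠ n - k := by
      rw [← hcent]
      intro h
      have e1 := hι' (i + 1) (by omega)
      rw [h, hι' (n - 1) (by omega)] at e1
      omega
    apply hlt _ _ _ (Nat.mod_lt _ (by omega)).le
    by_contra hge
    rw [rotDigit_of_lt (by omega)] at hc
    omega

end Renormalization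

/-! ### The renormalised map -/

section Return

variable {n k : ℕ} {β α : ℝ}

theorem rotDigit_eq_zero_or_one (hkn : k < n) (i : ℕ) :
    rotDigit n k i = 0 ∨ rotDigit n k i = 1 := by
  by_cases h : i * k % n + k < n
  · exact Or.inl (rotDigit_of_lt h)
  · exact Or.inr (rotDigit_of_le hkn (not_lt.1 h))

/-- Here `T` is either map: its value at the critical point is irrelevant, since the intervals to
which it is applied lie on one side of [u, v] and u < p < v. The rotation word thus dictates the
branches. -/
theorem RenormOrder.iterate_eq {u v : ℝ} (H : RenormOrder n k β α u v) (hkn : k < n)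
    (hβ : 1 < β) (hu : u < critPt β α) (hv : critPt β α < v) {T : ℝ → ℝ}
    (hT0 : ∀ x < critPt β α, T x = β * x + α) (hT1 : ∀ x > critPt β α, T x = β * x + α - 1)
    {t : ℝ} (ht : t ∈ Icc 0 (β - 1)) {i : ℕ} (hi : i + 2 ≤ n) :
    T^[i] (leftPt n k β α 1 + t) = leftPt n k β α (i + 1) + β ^ i * t := by
  induction i with
  | zero => simp
  | succ i ih =>
    rw [Function.iterate_succ_apply', ih (by omega)]
    have h0 : 0 ≤ β ^ i * t := mul_nonneg (by positivity) ht.1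
    have h1 : β ^ i * t ≤ (β - 1) * β ^ i := by
      rw [mul_comm]
      exact mul_le_mul_of_nonneg_right ht.2 (by positivity)
    have hs : leftPt n k β α (i + 1 + 1) =
        β * leftPt n k β α (i + 1) + α - rotDigit n k (i + 1) := rfl
    rcases rotDigit_eq_zero_or_one hkn (i + 1) with hc | hc
    · have h2 := H.rightPt_le i (by omega) hc
      rw [rightPt] at h2
      rw [hT0 _ (by linarith), hs, hc]
      push_cast
      ring
    · have h2 := H.le_leftPt i (by omega) hc
      rw [hT1 _ (by linarith), hs, hc]
      push_cast
      ring

variable {T : ℝ → ℝ}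

theorem mul_critPt_sub_left (hβ : 1 < β) :
    β * (β * (critPt β α - leftPt n k β α (n - 1))) = β - renormLevel n k β α := by
  rw [renormLevel, mul_sub, mul_critPt hβ]
  ring

theorem mul_right_sub_critPt (hn : 2 ≤ n) (hβ : 1 < β) :
    β * (β * (rightPt n k β α (n - 2) - critPt β α)) =
      renormLevel n k β α + β ^ n * (β - 1) - β := by
  rw [← mul_rightPt_sub_two hn, mul_sub, mul_critPt hβ]
  ring

theorem leftPt_lt_critPt (hn : n ≠ 0) (hβ : 1 < β)
    (h2 : renormLevel n k β α ≤ 2 * β - 1 - β ^ n * (β - 1)) :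
    leftPt n k β α (n - 1) < critPt β α := by
  have hβ0 : 0 < β := by linarith
  have e := mul_critPt_sub_left (n := n) (k := k) (α := α) hβ
  have h1 : 1 < β ^ n := one_lt_pow₀ hβ hn
  have : 0 < β * (β * (critPt β α - leftPt n k β α (n - 1))) := by nlinarith
  exact sub_pos.1 ((mul_pos_iff_of_pos_left hβ0).1 ((mul_pos_iff_of_pos_left hβ0).1 this))

theorem critPt_lt_rightPt (hn : 2 ≤ n) (hβ : 1 < β) (h1 : 1 ≤ renormLevel n k β α) :
    critPt β α < rightPt n k β α (n - 2) := by
  have hβ0 : 0 < β := by linarith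
  have hβn : 1 < β ^ n := one_lt_pow₀ hβ (by omega)
  have e := mul_right_sub_critPt (k := k) (α := α) hn hβ
  have : 0 < β * (β * (rightPt n k β α (n - 2) - critPt β α)) := by nlinarith
  exact sub_pos.1 ((mul_pos_iff_of_pos_left hβ0).1 ((mul_pos_iff_of_pos_left hβ0).1 this))

/-- A point of the left half takes the left branch, then the right one, landing in [α, α + β - 1];
`h1` keeps it above the left end. The other `n - 2` steps follow the rotation word. -/
theorem iterate_of_le_critPt (hn : 2 ≤ n) (hk : 0 < k) (hkn : k < n) (hgcd : Nat.gcd n k = 1)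
    (hβ : 1 < β) (h1 : 1 ≤ renormLevel n k β α)
    (h2 : renormLevel n k β α ≤ 2 * β - 1 - β ^ n * (β - 1))
    (hT0 : ∀ x < critPt β α, T x = β * x + α) (hT1 : ∀ x > critPt β α, T x = β * x + α - 1)
    {x : ℝ} (hux : leftPt n k β α (n - 1) ≤ x) (hxp : x ≤ critPt β α) (hx : T x = β * x + α) :
    T^[n] x = rightPt n k β α (n - 2) + β ^ n * (x - critPt β α) := by
  have H := renormOrder hn hk hkn hgcd hβ h1 h2
  have hu := leftPt_lt_critPt (by omega) hβ h2
  have hv := critPt_lt_rightPt hn hβ h1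
  have hβ0 : 0 < β := by linarith
  have hp := mul_critPt (a := α) hβ
  have hx1 : β * leftPt n k β α (n - 1) ≤ β * x := mul_le_mul_of_nonneg_left hux hβ0.le
  have hTx : critPt β α < T x := by
    rw [hx]
    linarith [H.le_image_left]
  have hleft1 : leftPt n k β α 1 = α := by
    rw [leftPt, leftPt, rotDigit_of_lt (by simpa using hkn)]
    simp
  have hTTx : T (T x) = leftPt n k β α 1 + (β - 1 - β * (β * (critPt β α - x))) := by
    rw [hT1 _ hTx, hx, hleft1]
    linear_combination β * hp
  have ht : β - 1 - β * (β * (critPt β α - x)) ∈ Icc 0 (β - 1) := by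
    have e := mul_critPt_sub_left (n := n) (k := k) (α := α) hβ
    constructor
    · have : β * (β * (critPt β α - x)) ≤ β * (β * (critPt β α - leftPt n k β α (n - 1))) := by
        gcongr
      linarith
    · have : 0 ≤ β * (β * (critPt β α - x)) :=
        mul_nonneg hβ0.le (mul_nonneg hβ0.le (sub_nonneg.2 hxp))
      linarith
  have hn2 : T^[n] x = T^[n - 2] (T (T x)) := by
    obtain ⟨m, rfl⟩ := Nat.exists_eq_add_of_le' hn
    rw [Nat.add_sub_cancel, Function.iterate_add_apply]
    rfl
  rw [hn2, hTTx, H.iterate_eq hkn hβ hu hv hT0 hT1 ht (by omega), rightPt]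
  obtain ⟨m, rfl⟩ := Nat.exists_eq_add_of_le' hn
  rw [Nat.add_sub_cancel]
  ring

theorem iterate_of_critPt_le (hn : 2 ≤ n) (hk : 0 < k) (hkn : k < n) (hgcd : Nat.gcd n k = 1)
    (hβ : 1 < β) (h1 : 1 ≤ renormLevel n k β α)
    (h2 : renormLevel n k β α ≤ 2 * β - 1 - β ^ n * (β - 1))
    (hT0 : ∀ x < critPt β α, T x = β * x + α) (hT1 : ∀ x > critPt β α, T x = β * x + α - 1)
    {x : ℝ} (hxv : x ≤ rightPt n k β α (n - 2)) (hxp : critPt β α ≤ x)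
    (hx : T x = β * x + α - 1) :
    T^[n] x = leftPt n k β α (n - 1) + β ^ n * (x - critPt β α) := by
  have H := renormOrder hn hk hkn hgcd hβ h1 h2
  have hu := leftPt_lt_critPt (by omega) hβ h2
  have hv := critPt_lt_rightPt hn hβ h1
  have hβ0 : 0 < β := by linarith
  have hp := mul_critPt (a := α) hβ
  have hx1 : β * x ≤ β * rightPt n k β α (n - 2) := mul_le_mul_of_nonneg_left hxv hβ0.le
  have hTx : T x < critPt β α := by
    rw [hx]
    linarith [H.image_right_le]
  have hleft1 : leftPt n k β α 1 = α := by
    rw [leftPt, leftPt, rotDigit_of_lt (by simpa using hkn)]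
    simp
  have hTTx : T (T x) = leftPt n k β α 1 + β * (β * (x - critPt β α)) := by
    rw [hT0 _ hTx, hx, hleft1]
    linear_combination β * hp
  have ht : β * (β * (x - critPt β α)) ∈ Icc 0 (β - 1) := by
    have e := mul_right_sub_critPt (k := k) (α := α) hn hβ
    constructor
    · exact mul_nonneg hβ0.le (mul_nonneg hβ0.le (sub_nonneg.2 hxp))
    · have : β * (β * (x - critPt β α)) ≤ β * (β * (rightPt n k β α (n - 2) - critPt β α)) := by
        gcongr
      linarith
  have hn2 : T^[n] x = T^[n - 2] (T (T x)) := by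
    obtain ⟨m, rfl⟩ := Nat.exists_eq_add_of_le' hn
    rw [Nat.add_sub_cancel, Function.iterate_add_apply]
    rfl
  rw [hn2, hTTx, H.iterate_eq hkn hβ hu hv hT0 hT1 ht (by omega)]
  obtain ⟨m, rfl⟩ := Nat.exists_eq_add_of_le' hn
  rw [Nat.add_sub_cancel, show m + 2 - 1 = m + 1 by omega]
  ring

/-- The affine chart of the central interval. -/
noncomputable def chart (n k : ℕ) (β α y : ℝ) : ℝ :=
  leftPt n k β α (n - 1) + (β - 1) * β ^ (n - 2) * y

theorem chart_lt_chart (hβ : 1 < β) {y z : ℝ} :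
    chart n k β α y < chart n k β α z ↔ y < z := by
  have : 0 < (β - 1) * β ^ (n - 2) := mul_pos (by linarith) (by positivity)
  rw [chart, chart, add_lt_add_iff_left, mul_lt_mul_iff_right₀ this]

theorem chart_le_chart (hβ : 1 < β) {y z : ℝ} :
    chart n k β α y ≤ chart n k β α z ↔ y ≤ z := by
  rw [← not_lt, chart_lt_chart hβ, not_lt]

theorem chart_zero : chart n k β α 0 = leftPt n k β α (n - 1) := by simp [chart]

theorem chart_one (hn : 2 ≤ n) : chart n k β α 1 = rightPt n k β α (n - 2) := by
  rw [chart, rightPt_sub_two hn, mul_one]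

/-- This identity dictates `renormParam`: β² (p - u) = β - `renormLevel` fixes the relative position
of p in the central interval. -/
theorem chart_critPt (hn : 2 ≤ n) (hβ : 1 < β) :
    chart n k β α (critPt (β ^ n) (renormParam n k β α)) = critPt β α := by
  have e := mul_critPt_sub_left (n := n) (k := k) (α := α) hβ
  have hβ1 : β - 1 ≠ 0 := by linarith
  have hβ0 : β ≠ 0 := by linarith
  have h : (β - 1) * β ^ (n - 2) * critPt (β ^ n) (renormParam n k β α) =
      (β - renormLevel n k β α) / (β * β) := by
    obtain ⟨m, rfl⟩ := Nat.exists_eq_add_of_le' hn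
    rw [critPt, renormParam, Nat.add_sub_cancel]
    field_simp
    ring
  rw [chart, h, ← e]
  field_simp
  ring

theorem upperMap_iterate_chart (hn : 2 ≤ n) (hk : 0 < k) (hkn : k < n) (hgcd : Nat.gcd n k = 1)
    (hβ : 1 < β) (h1 : 1 ≤ renormLevel n k β α)
    (h2 : renormLevel n k β α ≤ 2 * β - 1 - β ^ n * (β - 1)) {y : ℝ} (hy : y ∈ Icc (0 : ℝ) 1) :
    (upperMap β α)^[n] (chart n k β α y) =
      chart n k β α (upperMap (β ^ n) (renormParam n k β α) y) := by
  have hb : 1 < β ^ n := one_lt_pow₀ hβ (by omega)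
  have hp := mul_critPt (a := renormParam n k β α) hb
  have hcp := chart_critPt (k := k) (α := α) hn hβ
  have hT0 : ∀ x < critPt β α, upperMap β α x = β * x + α := fun x h => if_pos h
  have hT1 : ∀ x > critPt β α, upperMap β α x = β * x + α - 1 := fun x h => if_neg h.not_gt
  by_cases h : y < critPt (β ^ n) (renormParam n k β α)
  · have h' := (chart_lt_chart (n := n) (k := k) (α := α) hβ).2 h
    rw [hcp] at h'
    rw [iterate_of_le_critPt hn hk hkn hgcd hβ h1 h2 hT0 hT1
      (by rw [← chart_zero]; exact (chart_le_chart hβ).2 hy.1) h'.le (hT0 _ h'), upperMap,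
      if_pos h, ← hcp, ← chart_one hn]
    simp only [chart]
    linear_combination (-(β - 1) * β ^ (n - 2)) * hp
  · have h' := (chart_le_chart (n := n) (k := k) (α := α) hβ).2 (not_lt.1 h)
    rw [hcp] at h'
    rw [iterate_of_critPt_le hn hk hkn hgcd hβ h1 h2 hT0 hT1
      (by rw [← chart_one hn]; exact (chart_le_chart hβ).2 hy.2) h' (if_neg h'.not_gt), upperMap,
      if_neg h, ← hcp]
    simp only [chart]
    linear_combination (-(β - 1) * β ^ (n - 2)) * hp

theorem lowerMap_iterate_chart (hn : 2 ≤ n) (hk : 0 < k) (hkn : k < n) (hgcd : Nat.gcd n k = 1)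
    (hβ : 1 < β) (h1 : 1 ≤ renormLevel n k β α)
    (h2 : renormLevel n k β α ≤ 2 * β - 1 - β ^ n * (β - 1)) {y : ℝ} (hy : y ∈ Icc (0 : ℝ) 1) :
    (lowerMap β α)^[n] (chart n k β α y) =
      chart n k β α (lowerMap (β ^ n) (renormParam n k β α) y) := by
  have hb : 1 < β ^ n := one_lt_pow₀ hβ (by omega)
  have hp := mul_critPt (a := renormParam n k β α) hb
  have hcp := chart_critPt (k := k) (α := α) hn hβ
  have hT0 : ∀ x < critPt β α, lowerMap β α x = β * x + α := fun x h => if_pos h.le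
  have hT1 : ∀ x > critPt β α, lowerMap β α x = β * x + α - 1 := fun x h => if_neg h.not_ge
  by_cases h : y ≤ critPt (β ^ n) (renormParam n k β α)
  · have h' := (chart_le_chart (n := n) (k := k) (α := α) hβ).2 h
    rw [hcp] at h'
    rw [iterate_of_le_critPt hn hk hkn hgcd hβ h1 h2 hT0 hT1
      (by rw [← chart_zero]; exact (chart_le_chart hβ).2 hy.1) h' (if_pos h'), lowerMap,
      if_pos h, ← hcp, ← chart_one hn]
    simp only [chart]
    linear_combination (-(β - 1) * β ^ (n - 2)) * hp
  · have h' := (chart_lt_chart (n := n) (k := k) (α := α) hβ).2 (not_le.1 h)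
    rw [hcp] at h'
    rw [iterate_of_critPt_le hn hk hkn hgcd hβ h1 h2 hT0 hT1
      (by rw [← chart_one hn]; exact (chart_le_chart hβ).2 hy.2) h'.le (hT1 _ h'), lowerMap,
      if_neg h, ← hcp]
    simp only [chart]
    linear_combination (-(β - 1) * β ^ (n - 2)) * hp

theorem renormParam_mem_iff (hβ : 1 < β) : renormParam n k β α ∈ Icc 0 (2 - β ^ n) ↔
    1 ≤ renormLevel n k β α ∧ renormLevel n k β α ≤ 2 * β - 1 - β ^ n * (β - 1) := by
  have h : 0 < β - 1 := by linarith
  rw [renormParam, mem_Icc, div_le_iff₀ h, le_div_iff₀ h, zero_mul]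
  constructor <;> rintro ⟨h1, h2⟩ <;> constructor <;> linarith

theorem iterate_semiconj {f g : ℝ → ℝ} {φ : ℝ → ℝ} {s : Set ℝ} (hg : ∀ y ∈ s, g y ∈ s)
    (h : ∀ y ∈ s, f (φ y) = φ (g y)) {y : ℝ} (hy : y ∈ s) (j : ℕ) :
    f^[j] (φ y) = φ (g^[j] y) := by
  induction j generalizing y with
  | zero => rfl
  | succ j ih => rw [Function.iterate_succ_apply, Function.iterate_succ_apply, h y hy, ih (hg y hy)]

theorem finite_range_of_iterate {A : Type*} {f : A → A} {n : ℕ} (hn : 0 < n) {x : A}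
    (h : (range fun j => (f^[n])^[j] x).Finite) : (range fun i => f^[i] x).Finite := by
  refine ((Set.finite_lt_nat n).biUnion fun r _ => h.image f^[r]).subset ?_
  rintro _ ⟨i, rfl⟩
  refine mem_biUnion (x := i % n) (Nat.mod_lt i hn) ⟨_, ⟨i / n, rfl⟩, ?_⟩
  simp only
  rw [← Function.iterate_mul, ← Function.iterate_add_apply, Nat.mod_add_div]

theorem isSubshiftOfFiniteType_of_renormParam (hn : 2 ≤ n) (hk : 0 < k) (hkn : k < n)
    (hgcd : Nat.gcd n k = 1) (hβ : 1 < β) (hα : renormParam n k β α ∈ Icc 0 (2 - β ^ n))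
    (hP : PeriodicCrit (β ^ n) (renormParam n k β α)) :
    IsSubshiftOfFiniteType (betaShift β α) := by
  have hb : 1 < β ^ n := one_lt_pow₀ hβ (by omega)
  obtain ⟨h1, h2⟩ := (renormParam_mem_iff hβ).1 hα
  have H := renormOrder hn hk hkn hgcd hβ h1 h2
  have hp := critPt_mem_unit hb hα
  obtain ⟨⟨P, hP0, hP⟩, ⟨P', hP0', hP'⟩⟩ := hP
  refine isSubshiftOfFiniteType_betaShift hβ H.nonneg H.le_two_sub (P := n * P) (P' := n * P')
    (by positivity) (by positivity) ?_ ?_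
  · rw [Function.iterate_mul, ← chart_critPt (k := k) hn hβ,
      iterate_semiconj (fun y => lowerMap_mem_unit hb hα)
        (fun y => lowerMap_iterate_chart hn hk hkn hgcd hβ h1 h2) hp, hP]
  · rw [Function.iterate_mul, ← chart_critPt (k := k) hn hβ,
      iterate_semiconj (fun y => upperMap_mem_unit hb hα)
        (fun y => upperMap_iterate_chart hn hk hkn hgcd hβ h1 h2) hp, hP']

theorem isSofic_of_renormParam (hn : 2 ≤ n) (hk : 0 < k) (hkn : k < n)
    (hgcd : Nat.gcd n k = 1) (hβ : 1 < β) (hα : renormParam n k β α ∈ Icc 0 (2 - β ^ n))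
    (hP : FiniteCrit (β ^ n) (renormParam n k β α)) :
    IsSofic (betaShift β α) := by
  have hb : 1 < β ^ n := one_lt_pow₀ hβ (by omega)
  obtain ⟨h1, h2⟩ := (renormParam_mem_iff hβ).1 hα
  have H := renormOrder hn hk hkn hgcd hβ h1 h2
  have hp := critPt_mem_unit hb hα
  refine isSofic_betaShift hβ H.nonneg H.le_two_sub ?_ ?_
  · refine finite_range_of_iterate (n := n) (by omega) ?_
    rw [← chart_critPt (k := k) hn hβ]
    simp_rw [iterate_semiconj (fun y => lowerMap_mem_unit hb hα)
        (fun y => lowerMap_iterate_chart hn hk hkn hgcd hβ h1 h2) hp]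
    rw [range_comp' (chart n k β α)]
    exact hP.1.image _
  · refine finite_range_of_iterate (n := n) (by omega) ?_
    rw [← chart_critPt (k := k) hn hβ]
    simp_rw [iterate_semiconj (fun y => upperMap_mem_unit hb hα)
        (fun y => upperMap_iterate_chart hn hk hkn hgcd hβ h1 h2) hp]
    rw [range_comp' (chart n k β α)]
    exact hP.2.image _

end Return

/-! ### The non-transitivity interval -/

section Interval

variable {n k : ℕ} {β α : ℝ}

theorem sum_rotDigit_succ (i : ℕ) :
    ∑ l ∈ Finset.range (i + 1), (rotDigit n k l : ℝ) * β ^ (i + 1 - 1 - l) =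
      β * ∑ l ∈ Finset.range i, (rotDigit n k l : ℝ) * β ^ (i - 1 - l) + rotDigit n k i := by
  rw [Finset.sum_range_succ, Finset.mul_sum]
  congr 1
  · refine Finset.sum_congr rfl fun l hl => ?_
    have hl' := Finset.mem_range.1 hl
    rw [show i + 1 - 1 - l = i - 1 - l + 1 by omega]
    ring
  · simp

theorem leftPt_eq_sum (i : ℕ) : leftPt n k β α i = α * ∑ l ∈ Finset.range i, β ^ l -
    ∑ l ∈ Finset.range i, (rotDigit n k l : ℝ) * β ^ (i - 1 - l) := by
  induction i with
  | zero => simp [leftPt]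
  | succ i ih =>
    rw [leftPt, ih, sum_rotDigit_succ, geom_sum_succ]
    ring

theorem rotDigit_pred (hk : 0 < k) (hkn : k < n) : rotDigit n k (n - 1) = 1 := by
  apply rotDigit_of_le hkn
  have h1 := Nat.div_add_mod ((n - 1) * k) n
  have h2 : (n - 1) * k + k = n * k := by
    rw [← Nat.succ_mul, Nat.succ_eq_add_one, Nat.sub_add_cancel (by omega)]
  have h3 : (n - 1) * k / n < k := by
    rw [Nat.div_lt_iff_lt_mul (by omega), mul_comm k n]
    omega
  have h4 : n * ((n - 1) * k / n) + n ≤ n * k := by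
    rw [← Nat.mul_succ]
    exact Nat.mul_le_mul_left n h3
  omega

/-- The rotation word ends with `1`, so β u + α is one more than the n-th left end point, whose
closed form is known. -/
theorem renormLevel_eq (hk : 0 < k) (hkn : k < n) :
    renormLevel n k β α = α * (β * ∑ i ∈ Finset.range n, β ^ i) -
      β * (∑ l ∈ Finset.range n, (rotDigit n k l : ℝ) * β ^ (n - 1 - l) - 1) := by
  have h1 : leftPt n k β α n = β * leftPt n k β α (n - 1) + α - 1 := by
    obtain ⟨m, rfl⟩ := Nat.exists_eq_add_of_lt hkn
    have h := rotDigit_pred hk hkn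
    rw [Nat.add_sub_cancel] at h
    rw [leftPt, Nat.add_sub_cancel, h, Nat.cast_one]
  have h2 : renormLevel n k β α = β * (leftPt n k β α n + 1) := by
    rw [h1, renormLevel]
    ring
  rw [h2, leftPt_eq_sum]
  ring

theorem ceilDiv_eq {x t k : ℕ} (h1 : t * k < x) (h2 : x ≤ (t + 1) * k) :
    (x + k - 1) / k = t + 1 := by
  have h3 : (t + 1) * k = t * k + k := Nat.succ_mul t k
  have h4 : (t + 1 + 1) * k = (t + 1) * k + k := Nat.succ_mul (t + 1) k
  apply Nat.div_eq_of_lt_le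
  · omega
  · omega

/-- The V-th letter `1` occurs where `l * k / n` jumps to V, that is at l + 1 = ⌈V n / k⌉; the
quotient in the exponent is this ceiling. -/
theorem sum_rotDigit_eq_sum_ceil (hkn : k < n) (t : ℕ) :
    ∑ l ∈ Finset.range t, (rotDigit n k l : ℝ) * β ^ (n - 1 - l) =
      ∑ V ∈ Finset.Icc 1 (t * k / n), β ^ (n - (V * n + k - 1) / k) := by
  have hn : 0 < n := by omega
  induction t with
  | zero => simp
  | succ t ih =>
    have hmono : t * k / n ≤ (t + 1) * k / n :=
      Nat.div_le_div_right (Nat.mul_le_mul_right k (Nat.le_succ t))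
    rw [Finset.sum_range_succ, ih]
    rcases rotDigit_eq_zero_or_one hkn t with h | h
    · have : (t + 1) * k / n = t * k / n := by
        rw [rotDigit] at h
        omega
      rw [h, this]
      simp
    · have e : (t + 1) * k / n = t * k / n + 1 := by
        rw [rotDigit] at h
        omega
      have e1 : t * k < (t * k / n + 1) * n := by
        rw [add_mul, one_mul]
        exact Nat.lt_div_mul_add hn
      have e2 : (t * k / n + 1) * n ≤ (t + 1) * k := by
        rw [← e]
        exact Nat.div_mul_le_self _ _
      rw [e, Finset.sum_Icc_succ_top (Nat.le_add_left 1 _), h, ceilDiv_eq e1 e2, Nat.cast_one, one_mul,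
        show n - 1 - t = n - (t + 1) by omega]

theorem sum_Icc_add {M : Type*} [AddCommMonoid M] (f : ℕ → M) (a d : ℕ) :
    ∑ i ∈ Finset.Icc 1 (a + d), f i =
      ∑ i ∈ Finset.Icc 1 a, f i + ∑ i ∈ Finset.Icc 1 d, f (a + i) := by
  induction d with
  | zero => simp
  | succ d ih =>
    rw [← add_assoc, Finset.sum_Icc_succ_top (by omega), ih, Finset.sum_Icc_succ_top (by omega),
      add_assoc, add_assoc]

theorem quotV_last (hs : 0 < n % k) : quotV n k (n % k) = k :=
  Nat.mul_div_cancel_left k hs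

/-- The double sum is a single sum over V = V_{j-1} + i. The V with V_{j-1} < V ≤ V_j are those with
⌈V s / k⌉ = j, so ⌈V n / k⌉ = V q + j. As V_s = k, the exponent (k - V) q + s - j equals n - ⌈V n /
k⌉. -/
theorem sum_sumW_eq_sum_ceil (hs : 0 < n % k) {t : ℕ} (ht : t ≤ n % k) :
    ∑ j ∈ Finset.Icc 1 t, sumW n k β j =
      ∑ V ∈ Finset.Icc 1 (quotV n k t), β ^ (n - (V * n + k - 1) / k) := by
  induction t with
  | zero => simp [quotV]
  | succ t ih =>
    have hmono : quotV n k t ≤ quotV n k (t + 1) :=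
      Nat.div_le_div_right (Nat.mul_le_mul_right k (Nat.le_succ t))
    have hlast : quotV n k (t + 1) ≤ k := by
      refine le_of_le_of_eq ?_ (quotV_last hs)
      exact Nat.div_le_div_right (Nat.mul_le_mul_right k ht)
    rw [Finset.sum_Icc_succ_top (by omega), ih (by omega)]
    conv_rhs => rw [← Nat.add_sub_cancel' hmono]
    rw [sum_Icc_add, sumW, quotV_last hs, Nat.add_sub_cancel]
    congr 1
    refine Finset.sum_congr rfl fun i hi => ?_
    obtain ⟨hi1, hi2⟩ := Finset.mem_Icc.1 hi
    congr 1
    have hVk : quotV n k t + i ≤ k := by omega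
    have e1 : t * k < (quotV n k t + i) * (n % k) := by
      have h : t * k < (t * k / (n % k) + 1) * (n % k) := by
        rw [add_mul, one_mul]
        exact Nat.lt_div_mul_add hs
      exact h.trans_le (Nat.mul_le_mul_right _ (Nat.add_le_add_left hi1 _))
    have e2 : (quotV n k t + i) * (n % k) ≤ (t + 1) * k :=
      (Nat.mul_le_mul_right _ (show quotV n k t + i ≤ quotV n k (t + 1) by omega)).trans
        (Nat.div_mul_le_self _ _)
    rw [Nat.sub_sub]
    generalize quotV n k t + i = V at hVk e1 e2 ⊢
    have hdm := Nat.div_add_mod n k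
    obtain ⟨d, hd⟩ := Nat.exists_eq_add_of_le hVk
    have e3 : V * n = V * (n / k) * k + V * (n % k) := by
      conv_lhs => rw [← hdm]
      ring
    have e4 : (V * n + k - 1) / k = V * (n / k) + t + 1 := by
      apply ceilDiv_eq
      · rw [e3, add_mul]
        omega
      · rw [e3, add_assoc, add_mul (V * (n / k))]
        omega
    have e5 : n = V * (n / k) + d * (n / k) + n % k := by
      conv_lhs => rw [← hdm]
      rw [← add_mul, ← hd]
    rw [e4, show k - V = d by omega]
    omega

theorem mem_nonTransInterval_iff (hn : 2 ≤ n) (hk : 0 < k) (hkn : k < n)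
    (hgcd : Nat.gcd n k = 1) (hβ : 1 < β) :
    α ∈ nonTransInterval n k β ↔ renormParam n k β α ∈ Icc 0 (2 - β ^ n) := by
  have hD : 0 < β * ∑ i ∈ Finset.range n, β ^ i := by
    have : 0 < ∑ i ∈ Finset.range n, β ^ i :=
      Finset.sum_pos (fun i _ => by positivity) (Finset.nonempty_range_iff.2 (by omega))
    have : 0 < β := by linarith
    positivity
  rw [renormParam_mem_iff hβ, renormLevel_eq hk hkn, sum_rotDigit_eq_sum_ceil hkn,
    Nat.mul_div_cancel_left k (by omega), nonTransInterval]
  by_cases hk1 : k = 1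
  · subst hk1
    rw [if_pos rfl, mem_Icc, div_le_iff₀ hD, le_div_iff₀ hD]
    simp only [Finset.Icc_self, Finset.sum_singleton, one_mul, Nat.add_sub_cancel, Nat.div_one,
      Nat.sub_self, pow_zero, sub_self, mul_zero, sub_zero]
    have : 2 * β - 1 - β ^ n * (β - 1) = -β ^ (n + 1) + β ^ n + 2 * β - 1 := by ring
    rw [this]
  · have hs : 0 < n % k := by
      refine Nat.pos_of_ne_zero fun h => hk1 ?_
      rw [← hgcd]
      exact (Nat.gcd_eq_right (Nat.dvd_of_mod_eq_zero h)).symm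
    rw [if_neg hk1, mem_Icc, div_le_iff₀ hD, le_div_iff₀ hD, sum_sumW_eq_sum_ceil hs le_rfl,
      quotV_last hs]
    generalize ∑ V ∈ Finset.Icc 1 k, β ^ (n - (V * n + k - 1) / k) = S
    have hpow : β ^ (n + 1) = β * β ^ n := pow_succ' β n
    constructor <;> rintro ⟨h1, h2⟩ <;> constructor <;> linarith

/-- Density of a set of renormalised parameters passes to the non-transitivity interval. -/
theorem nonTransInterval_subset_closure (hn : 2 ≤ n) (hk : 0 < k) (hkn : k < n)
    (hgcd : Nat.gcd n k = 1) (hβ : 1 < β) {p q : ℝ → Prop}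
    (hp : Icc 0 (2 - β ^ n) ⊆ closure {a | a ∈ Icc 0 (2 - β ^ n) ∧ p a})
    (hpq : ∀ α, renormParam n k β α ∈ Icc 0 (2 - β ^ n) → p (renormParam n k β α) → q α) :
    nonTransInterval n k β ⊆ closure {α | α ∈ nonTransInterval n k β ∧ q α} := by
  have hmem : ∀ α, α ∈ nonTransInterval n k β ↔ renormParam n k β α ∈ Icc 0 (2 - β ^ n) :=
    fun α => mem_nonTransInterval_iff hn hk hkn hgcd hβ
  have hβ1 : β - 1 ≠ 0 := by linarith
  have hD : β * ∑ i ∈ Finset.range n, β ^ i ≠ 0 := by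
    have : 0 < ∑ i ∈ Finset.range n, β ^ i :=
      Finset.sum_pos (fun i _ => by positivity) (Finset.nonempty_range_iff.2 (by omega))
    exact mul_ne_zero (by linarith) this.ne'
  set D := β * ∑ i ∈ Finset.range n, β ^ i with hDdef
  obtain ⟨c, hc⟩ : ∃ c, ∀ α, renormParam n k β α = D / (β - 1) * α + c := by
    refine ⟨-(β * (∑ l ∈ Finset.range n, (rotDigit n k l : ℝ) * β ^ (n - 1 - l) - 1) + 1) /
      (β - 1), fun α => ?_⟩
    rw [renormParam, renormLevel_eq hk hkn]
    field_simp
    ring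
  -- As a nonconstant affine map, `renormParam` is a homeomorphism of the line, so preimages commute
  -- with closures.
  let φ : ℝ ≃ₜ ℝ := affineHomeomorph (D / (β - 1)) c (div_ne_zero hD hβ1)
  have hφ : ∀ α, φ α = renormParam n k β α := fun α => (hc α).symm
  intro α hα
  have h1 : φ α ∈ closure {a | a ∈ Icc 0 (2 - β ^ n) ∧ p a} := by
    rw [hφ]
    exact hp ((hmem α).1 hα)
  have h2 : α ∈ φ ⁻¹' closure {a | a ∈ Icc 0 (2 - β ^ n) ∧ p a} := h1
  rw [φ.preimage_closure] at h2
  refine closure_mono ?_ h2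
  rintro x ⟨hx1, hx2⟩
  rw [hφ] at hx1 hx2
  exact ⟨(hmem x).2 hx1, hpq x hx1 hx2⟩

end Interval

/-! ### The density theorem -/

theorem corollary1p4 (n k : ℕ) (hn : 2 ≤ n) (hkn : k < n) (hgcd : Nat.gcd n k = 1) :
    (∀ (m : ℕ) (b : ℝ), 2 ≤ m → IsMultinacci m b →
      nonTransInterval n k (b ^ (1 / (n : ℝ))) ⊆
        closure {α | α ∈ nonTransInterval n k (b ^ (1 / (n : ℝ))) ∧
          IsSubshiftOfFiniteType (betaShift (b ^ (1 / (n : ℝ))) α)}) ∧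
    (∀ b : ℝ, IsPisot b →
      nonTransInterval n k (b ^ (1 / (n : ℝ))) ⊆
        closure {α | α ∈ nonTransInterval n k (b ^ (1 / (n : ℝ))) ∧
          IsSofic (betaShift (b ^ (1 / (n : ℝ))) α)}) := by
  have hk : 0 < k := by
    rcases Nat.eq_zero_or_pos k with rfl | h
    · rw [Nat.gcd_zero_right] at hgcd
      omega
    · exact h
  have hroot : ∀ b : ℝ, 1 < b → 1 < b ^ (1 / (n : ℝ)) ∧ (b ^ (1 / (n : ℝ))) ^ n = b := by
    intro b hb
    refine ⟨Real.one_lt_rpow hb (by positivity), ?_⟩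
    rw [one_div]
    exact Real.rpow_inv_natCast_pow (by linarith) (by omega)
  constructor
  · intro m b _ hm
    obtain ⟨hβ, hβn⟩ := hroot b hm.1
    refine nonTransInterval_subset_closure hn hk hkn hgcd hβ (p := PeriodicCrit b) ?_ ?_
    · rw [hβn]
      exact hm.dense_periodicCrit
    · intro α h1 h2
      exact isSubshiftOfFiniteType_of_renormParam hn hk hkn hgcd hβ h1 (by rwa [hβn])
  · intro b hb
    obtain ⟨hβ, hβn⟩ := hroot b hb.2.1
    refine nonTransInterval_subset_closure hn hk hkn hgcd hβ (p := FiniteCrit b) ?_ ?_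
    · rw [hβn]
      exact hb.dense_finiteCrit
    · intro α h1 h2
      exact isSofic_of_renormParam hn hk hkn hgcd hβ h1 (by rwa [hβn])
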